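/- Let $d\ge 0$, let $\mathcal O=\mathcal O(\mathbb C^d,0)$ be the ring of germs at the origin of holomorphic functions, and let $\mathrm{Diff}(\mathbb C^d,0)$ be the group, under composition, of germs of invertible holomorphic self-maps of $(\mathbb C^d,0)$. A subgroup $G\subset\mathrm{Diff}(\mathbb C^d,0)$ is called finitely generated if there are finitely many $F_1,\dots,F_p\in\mathrm{Diff}(\mathbb C^d,0)$ and finitely many germs of holomorphic vector fields $v_1,\dots,v_q$ vanishing at $0$ ($p=0$ or $q=0$ allowed) such that $G$ is generated, as a group, by the $F_i$ and all the flow maps $e^{tv_j}$, $t\in\mathbb C$, where $\{e^{tv}\}_{t\in\mathbb C}\subset\mathrm{Diff}(\mathbb C^d,0)$ is the holomorphic one-parameter group with $\frac{d}{dt}e^{tv}|_{t=0}=v$. For germs $X,Y$ at $0$ of analytic subvarieties of $\mathbb C^d$, let $I_X,I_Y\subset\mathcal O$ be the ideals of germs vanishing on $X$ and on $Y$, and let $\mu(X,Y)=\dim_{\mathbb C}\mathcal O/(I_X+I_Y)\in\mathbb N\cup\{\infty\}$ be their intersection multiplicity. Theorem. Let $G\subset\mathrm{Diff}(\mathbb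 C^d,0)$ be a commutative finitely generated subgroup and let $X,Y$ be germs at $0$ of analytic subvarieties of $\mathbb C^d$. Then there is a constant $m\in\mathbb N$ (depending on $G$, $X$, $Y$) such that for every $g\in G$ for which the intersection of $g^{-1}(X)$ and $Y$ is isolated, i.e. contains no points other than the origin in some neighbourhood of the origin, one has $\mu(g^{-1}(X),Y)\le m$. -/

import Mathlib

open Filter Topology

noncomputable section

namespace LocalDynamics

/-- The complex space `ℂ^d`. -/
abbrev Cd (d : ℕ) : Type := Fin d → ℂ

/-! ### Germs of holomorphic functions -/

/-- The ring `𝒪(ℂ^d, 0)` of germs at the origin of holomorphic functions. -/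
def HolGerm (d : ℕ) : Subring (Germ (𝓝 (0 : Cd d)) ℂ) where
  carrier := {φ | ∃ f : Cd d → ℂ, AnalyticAt ℂ f 0 ∧ φ = (f : Germ (𝓝 (0 : Cd d)) ℂ)}
  mul_mem' := by
    rintro _ _ ⟨f, hf, rfl⟩ ⟨g, hg, rfl⟩
    exact ⟨f * g, hf.mul hg, rfl⟩
  one_mem' := ⟨fun _ => 1, analyticAt_const, rfl⟩
  add_mem' := by
    rintro _ _ ⟨f, hf, rfl⟩ ⟨g, hg, rfl⟩
    exact ⟨f + g, hf.add hg, rfl⟩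
  zero_mem' := ⟨fun _ => 0, analyticAt_const, rfl⟩
  neg_mem' := by
    rintro _ ⟨f, hf, rfl⟩
    exact ⟨-f, hf.neg, rfl⟩

/-- The embedding of `ℂ` into `𝒪(ℂ^d, 0)` as germs of constant functions. -/
def constHom (d : ℕ) : ℂ →+* HolGerm d where
  toFun c := ⟨((fun _ => c : Cd d → ℂ) : Germ (𝓝 (0 : Cd d)) ℂ),
    fun _ => c, analyticAt_const, rfl⟩
  map_one' := rfl
  map_mul' _ _ := rfl
  map_zero' := rfl
  map_add' _ _ := rfl

/-- `𝒪(ℂ^d, 0)` is a `ℂ`-algebra through the constant germs. -/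
instance (d : ℕ) : Algebra ℂ (HolGerm d) := (constHom d).toAlgebra

/-! ### Germs of holomorphic self-maps -/

/-- Germs of holomorphic self-maps `(ℂ^d, 0) → (ℂ^d, 0)`, not necessarily invertible. -/
@[ext]
structure HolSelfMap (d : ℕ) where
  germ : Germ (𝓝 (0 : Cd d)) (Cd d)
  isHol : ∃ f : Cd d → Cd d, AnalyticAt ℂ f 0 ∧ f 0 = 0 ∧ germ = (f : Germ (𝓝 (0 : Cd d)) (Cd d))

theorem HolSelfMap.tendsto {d : ℕ} (F : HolSelfMap d) : F.germ.Tendsto (𝓝 0) := by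
  obtain ⟨f, hf, h0, h⟩ := F.isHol
  rw [h, Germ.coe_tendsto]
  have := hf.continuousAt.tendsto
  rwa [h0] at this

/-- Germs of holomorphic self-maps form a monoid under composition: `F * G = F ∘ G`. -/
instance (d : ℕ) : Monoid (HolSelfMap d) where
  mul F G := ⟨F.germ.compTendsto' G.germ G.tendsto, by
    rcases F with ⟨_, f, hf, hf0, rfl⟩
    rcases G with ⟨_, g, hg, hg0, rfl⟩
    exact ⟨f ∘ g, AnalyticAt.comp (by rwa [hg0]) hg, by simp [hg0, hf0], rfl⟩⟩
  one := ⟨((fun x => x : Cd d → Cd d) : Germ (𝓝 (0 : Cd d)) (Cd d)),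
    fun x => x, analyticAt_id, rfl, rfl⟩
  mul_assoc := by
    rintro ⟨_, f, hf, hf0, rfl⟩ ⟨_, g, hg, hg0, rfl⟩ ⟨_, h, hh, hh0, rfl⟩
    rfl
  one_mul := by
    rintro ⟨_, f, hf, hf0, rfl⟩
    rfl
  mul_one := by
    rintro ⟨_, f, hf, hf0, rfl⟩
    rfl

/-- The group `Diff(ℂ^d, 0)` of germs of invertible holomorphic self-maps of `(ℂ^d, 0)`,
with composition as the group law. -/
abbrev Diff (d : ℕ) : Type := (HolSelfMap d)ˣ

/-! ### Flows and finitely generated groups -/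

/-- `φ : ℂ → Diff(ℂ^d, 0)` is the flow `φ t = e^{tv}` of the germ at the origin of the holomorphic
vector field `v` with a singular point at the origin: a holomorphic one-parameter subgroup such that
`d/dt φ t = v` at `t = 0`. -/
def IsFlow {d : ℕ} (v : Cd d → Cd d) (φ : ℂ → Diff d) : Prop :=
  AnalyticAt ℂ v 0 ∧ v 0 = 0 ∧
  (∀ s t : ℂ, φ (s + t) = φ s * φ t) ∧
  ∃ Φ : ℂ × Cd d → Cd d, AnalyticAt ℂ Φ (0, 0) ∧
    (∀ᶠ t in 𝓝 (0 : ℂ),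
      (φ t : HolSelfMap d).germ = ((fun x => Φ (t, x) : Cd d → Cd d) : Germ (𝓝 (0 : Cd d)) (Cd d))) ∧
    ∀ᶠ x in 𝓝 (0 : Cd d), HasDerivAt (fun t : ℂ => Φ (t, x)) (v x) 0

/-- `G` is generated by finitely many invertible germs `F 1, …, F p` together with the flows
`e^{tv}`, `t ∈ ℂ`, of finitely many germs of holomorphic vector fields `v 1, …, v q`. -/
def IsFinitelyGenerated {d : ℕ} (G : Subgroup (Diff d)) : Prop :=
  ∃ (p q : ℕ) (F : Fin p → Diff d) (v : Fin q → Cd d → Cd d) (φ : Fin q → ℂ → Diff d),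
    (∀ j, IsFlow (v j) (φ j)) ∧
    G = Subgroup.closure (Set.range F ∪ ⋃ j, Set.range (φ j))

/-! ### Germs of analytic subvarieties and intersection multiplicity -/

/-- Germs at the origin of subsets of `ℂ^d`. -/
abbrev SetGerm (d : ℕ) : Type := Germ (𝓝 (0 : Cd d)) Prop

/-- The germ of a set is that of an analytic subvariety if near the origin the set is the common
zero locus of finitely many holomorphic functions. -/
def IsAnalyticSubvariety {d : ℕ} (X : SetGerm d) : Prop :=
  ∃ (n : ℕ) (f : Fin n → Cd d → ℂ), (∀ i, AnalyticAt ℂ (f i) 0) ∧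
    X = ((fun x => ∀ i, f i x = 0 : Cd d → Prop) : Germ (𝓝 (0 : Cd d)) Prop)

/-- The preimage `g⁻¹(X)` of the germ of a set. -/
def preimage {d : ℕ} (g : Diff d) (X : SetGerm d) : SetGerm d :=
  X.compTendsto' (g : HolSelfMap d).germ (g : HolSelfMap d).tendsto

/-- The (radical) ideal `I_X` of germs of holomorphic functions vanishing on `X`. -/
def vanishingIdeal {d : ℕ} (X : SetGerm d) : Ideal (HolGerm d) where
  carrier := {f | X.LiftRel (fun (P : Prop) (z : ℂ) => P → z = 0) (f : Germ (𝓝 (0 : Cd d)) ℂ)}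
  add_mem' := by
    induction X using Germ.inductionOn with | _ X =>
    rintro ⟨_, f, hf, rfl⟩ ⟨_, g, hg, rfl⟩ h₁ h₂
    change ∀ᶠ x in 𝓝 0, X x → f x = 0 at h₁
    change ∀ᶠ x in 𝓝 0, X x → g x = 0 at h₂
    change ∀ᶠ x in 𝓝 0, X x → f x + g x = 0
    filter_upwards [h₁, h₂] with x a b hx
    rw [a hx, b hx, add_zero]
  zero_mem' := by
    induction X using Germ.inductionOn with | _ X =>
    exact Eventually.of_forall fun _ _ => rfl
  smul_mem' := by
    induction X using Germ.inductionOn with | _ X =>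
    rintro ⟨_, f, hf, rfl⟩ ⟨_, g, hg, rfl⟩ h
    change ∀ᶠ x in 𝓝 0, X x → g x = 0 at h
    change ∀ᶠ x in 𝓝 0, X x → f x * g x = 0
    filter_upwards [h] with x a hx
    rw [a hx, mul_zero]

/-- The intersection multiplicity `μ(X, Y) = codim_ℂ ⟨I_X, I_Y⟩ ∈ ℕ ∪ {∞}`, the dimension over `ℂ`
of `𝒪(ℂ^d, 0) / (I_X + I_Y)`. -/
def intersectionMultiplicity {d : ℕ} (X Y : SetGerm d) : ℕ∞ :=
  (Module.rank ℂ (HolGerm d ⧸ (vanishingIdeal X ⊔ vanishingIdeal Y))).toENat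

/-- `X` and `Y` have no common points other than the origin in some neighbourhood of the origin. -/
def IsIsolatedIntersection {d : ℕ} (X Y : SetGerm d) : Prop :=
  (X ⊓ Y).LiftRel (fun (P : Prop) (x : Cd d) => P → x = 0)
    ((fun x => x : Cd d → Cd d) : Germ (𝓝 (0 : Cd d)) (Cd d))

end LocalDynamics

end

namespace LocalDynamics

open scoped NNReal ENNReal BoundedContinuousFunction

/-! ### Substituting an element of a Banach algebra for one variable of a power series. -/

section OperatorValued

/-! The multiplicity `μ(g⁻¹(X), Y)` is the codimension of the ideal `K_g = g^* I_X + I_Y`. The proof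
shows that the conditions "codimension at least `r`" cut out a decreasing chain of closed sets in a
Noetherian parameter space. Such a chain stabilizes at some `m`, so that codimension at least `m`
forces infinite codimension. Isolated intersections have finite codimension, hence are bounded by
`m`.

Parameters. By commutativity every `g ∈ G` is a product of powers `F_i ^ n_i` and flow maps `e^{t_j
v_j}`, so `G` is parametrized by `ℤ^p × ℂ^q` (`exists_parametrization`). The jet coefficients of
`g^* u` lie, for all `u` and all orders at once, in one finitely generated algebra of functions of
`(n, t)`, which is Noetherian by Hilbert's basis theorem. Here is why finitely many functions
suffice. On jets of any order the eigenvalues needed for `F^*` are products of eigenvalues on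
`𝒪/𝔪²`, since a product of generalized eigenvectors is again one and `𝔪/𝔪²` generates the jets.
Hence the coefficients of `(F^*)^n` are polynomials in `n` and finitely many `a^n`
(`exists_finset_zpow_coeff`). For a flow, eigenvalues of the infinitesimal generator add up, and the
coefficients are polynomials in `t` and finitely many `e^{at}` (`IsFlow.exists_finset_coeff`).

Closedness. By Nakayama, codimension less than `r` can be tested modulo `𝔪^r` (`codim_lt_coe_iff`).
There it says that jets of elements of `K_g` have large rank, that is, that some minor is nonzero;
`exists_codim_bound` combines this with the Noetherian property.

Finiteness. That an isolated intersection has finite codimension is a local analytic Nullstellensatz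
(`finite_quotient_of_isolated`), proved by induction on the dimension with Weierstrass division and
resultants. Weierstrass division itself comes from inverting an operator that depends analytically
on the parameter and equals the identity at the origin (`weierstrass_division_of_shift`). -/

theorem hasSum_pi_single_smul {F : Type*} [NormedAddCommGroup F] [NormedSpace ℂ F] (n : ℕ)
    (b : ℕ → F) : HasSum (fun k => (Pi.single n (1 : ℂ) : ℕ → ℂ) k • b k) (b n) := by
  have := hasSum_single (f := fun k => (Pi.single n (1 : ℂ) : ℕ → ℂ) k • b k) n
    (by intro k hk; simp [hk])
  simpa using this

variable {E : Type*} [NormedAddCommGroup E] [NormedSpace ℂ E]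

/-- The coefficient of `z ^ l` in the part of degree `m` in `x` of the power series
`p` of a function of `(x, z)`. -/
noncomputable def partialCoeff (p : FormalMultilinearSeries ℂ (E × ℂ) ℂ) (m l : ℕ) :
    ContinuousMultilinearMap ℂ (fun _ : Fin m => E) ℂ :=
  (p.changeOriginSeries m l fun _ => ((0 : E), (1 : ℂ))).compContinuousLinearMap
    fun _ => ContinuousLinearMap.inl ℂ E ℂ

/-- The vector `(0, 1)` and the inclusion of `E` have norm at most one, so the majorant known for
change of origin also controls these coefficients. -/
theorem nnnorm_partialCoeff_le (p : FormalMultilinearSeries ℂ (E × ℂ) ℂ) (m l : ℕ) :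
    ‖partialCoeff p m l‖₊ ≤
      ∑' _ : { s : Finset (Fin (m + l)) // s.card = l }, ‖p (m + l)‖₊ := by
  have h1 : ‖((0 : E), (1 : ℂ))‖₊ = 1 := by
    simp [Prod.nnnorm_def]
  have h2 := p.nnnorm_changeOriginSeries_apply_le_tsum m l ((0 : E), (1 : ℂ))
  rw [h1] at h2
  simp only [one_pow, mul_one] at h2
  refine le_trans ?_ h2
  rw [← NNReal.coe_le_coe]
  simp only [coe_nnnorm]
  refine (ContinuousMultilinearMap.norm_compContinuousLinearMap_le _ _).trans ?_
  refine mul_le_of_le_one_right (norm_nonneg _) ?_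
  exact Finset.prod_le_one (fun _ _ => norm_nonneg _) fun _ _ =>
    ContinuousLinearMap.norm_inl_le_one ℂ E ℂ

/-- Expand the recentering at `(0, z)` as a power series in its center; since `(0, z) = z • (0, 1)`,
multilinearity pulls out the factor `z ^ l`. -/
theorem hasSum_partialCoeff (p : FormalMultilinearSeries ℂ (E × ℂ) ℂ) (m : ℕ) {x : E} {z : ℂ}
    (hz : (‖z‖₊ : ℝ≥0∞) < p.radius) :
    HasSum (fun l => z ^ l * partialCoeff p m l fun _ => x)
      (p.changeOrigin ((0 : E), z) m fun _ => (x, 0)) := by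
  have hr : 0 < p.radius := lt_of_le_of_lt (zero_le) hz
  have hm : ((0 : E), z) ∈ Metric.eball (0 : E × ℂ) p.radius := by
    rw [mem_eball_zero_iff, enorm_eq_nnnorm, show ‖((0 : E), z)‖₊ = ‖z‖₊ by simp [Prod.nnnorm_def]]
    exact hz
  have := (p.hasFPowerSeriesOnBall_changeOrigin m hr).hasSum hm
  rw [zero_add] at this
  have h2 := ContinuousMultilinearMap.hasSum_eval this (fun _ => (x, (0 : ℂ)))
  convert! h2 using 2 with l
  have : (fun _ : Fin l => ((0 : E), z)) =
      fun i => (fun _ : Fin l => z) i • ((0 : E), (1 : ℂ)) := by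
    ext i <;> simp
  rw [this, ContinuousMultilinearMap.map_smul_univ]
  simp [partialCoeff]

variable {A : Type*} [NormedRing A] [NormedAlgebra ℂ A] [NormOneClass A]

/-- The power series in `x` of the function obtained from `p` by substituting `a` for `z`. -/
noncomputable def substSeries (p : FormalMultilinearSeries ℂ (E × ℂ) ℂ) (a : A) :
    FormalMultilinearSeries ℂ E A := fun m =>
  ∑' l, (ContinuousLinearMap.toSpanSingleton ℂ (a ^ l)).compContinuousMultilinearMap
    (partialCoeff p m l)

theorem nnnorm_substSeries_term_le (p : FormalMultilinearSeries ℂ (E × ℂ) ℂ) (a : A) (m l : ℕ) :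
    ‖(ContinuousLinearMap.toSpanSingleton ℂ (a ^ l)).compContinuousMultilinearMap
      (partialCoeff p m l)‖₊ ≤
    (∑' _ : { s : Finset (Fin (m + l)) // s.card = l }, ‖p (m + l)‖₊) * ‖a‖₊ ^ l := by
  rw [← NNReal.coe_le_coe]
  simp only [coe_nnnorm]
  refine (ContinuousLinearMap.norm_compContinuousMultilinearMap_le _ _).trans ?_
  rw [ContinuousLinearMap.norm_toSpanSingleton, mul_comm]
  push_cast
  gcongr
  · exact (NNReal.coe_le_coe.2 (nnnorm_partialCoeff_le p m l)).trans_eq (by push_cast; rfl)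
  · exact norm_pow_le a l

theorem summable_substSeries_term (p : FormalMultilinearSeries ℂ (E × ℂ) ℂ) {a : A}
    (ha : (‖a‖₊ : ℝ≥0∞) < p.radius) (m : ℕ) :
    Summable fun l => ‖(ContinuousLinearMap.toSpanSingleton ℂ (a ^ l)).compContinuousMultilinearMap
      (partialCoeff p m l)‖₊ := by
  refine NNReal.summable_of_le (nnnorm_substSeries_term_le p a m) ?_
  have := (NNReal.summable_sigma.1 <| p.changeOriginSeries_summable_aux₂ ha m).2
  simpa only [NNReal.tsum_mul_right] using this

/-- The double series over the degrees in `x` and in `a` is dominated by the one used for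
recentering `p` at a point of norm `‖a‖`. -/
theorem substSeries_radius (p : FormalMultilinearSeries ℂ (E × ℂ) ℂ) {a : A}  :
    p.radius - ‖a‖₊ ≤ (substSeries p a).radius := by
  refine ENNReal.le_of_forall_pos_nnreal_lt fun r _h0 hr => ?_
  rw [lt_tsub_iff_right, add_comm] at hr
  have ha : (‖a‖₊ : ℝ≥0∞) < p.radius := (le_add_right le_rfl).trans_lt hr
  apply FormalMultilinearSeries.le_radius_of_summable_nnnorm
  have h1 := (NNReal.summable_sigma.1 (p.changeOriginSeries_summable_aux₁ hr)).2
  refine NNReal.summable_of_le (fun m => ?_) h1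
  have h3 := p.changeOriginSeries_summable_aux₂ ha m
  have h2 : ‖substSeries p a m‖₊ ≤
      ∑' s : Σ l : ℕ, { s : Finset (Fin (m + l)) // s.card = l }, ‖p (m + s.1)‖₊ * ‖a‖₊ ^ s.1 := by
    rw [h3.tsum_sigma' (NNReal.summable_sigma.1 h3).1]
    have h4 := (NNReal.summable_sigma.1 h3).2
    refine tsum_of_nnnorm_bounded h4.hasSum fun l => ?_
    refine (nnnorm_substSeries_term_le p a m l).trans_eq ?_
    exact (NNReal.tsum_mul_right _ _).symm
  refine (mul_le_mul_left h2 _).trans_eq ?_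
  rw [← NNReal.tsum_mul_right]

variable [CompleteSpace A]

theorem hasSum_substSeries (p : FormalMultilinearSeries ℂ (E × ℂ) ℂ) {a : A}
    (ha : (‖a‖₊ : ℝ≥0∞) < p.radius) (m : ℕ) (v : Fin m → E) :
    HasSum (fun l => partialCoeff p m l v • a ^ l) (substSeries p a m v) := by
  have h := (summable_substSeries_term p ha m).of_nnnorm.hasSum
  simpa using! ContinuousMultilinearMap.hasSum_eval h v

/-- To `π` the element `a` looks like the scalar `z`, so applying `π` degree by degree in `x` turns
`p(x, a)` into `p(x, z) • π 1`. This is how operator identities are converted back into identities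
between functions. -/
theorem substSeries_sum_eval (p : FormalMultilinearSeries ℂ (E × ℂ) ℂ) {a : A} {F : Type*}
    [NormedAddCommGroup F] [NormedSpace ℂ F] (π : A →L[ℂ] F) {z : ℂ}
    (hπ : ∀ l, π (a ^ l) = z ^ l • π 1) {x : E}
    (ha : (‖a‖₊ + ‖x‖₊ : ℝ≥0∞) < p.radius) (hz : (‖z‖₊ + ‖x‖₊ : ℝ≥0∞) < p.radius) :
    π ((substSeries p a).sum x) = p.sum (x, z) • π 1 := by
  have ha' : (‖a‖₊ : ℝ≥0∞) < p.radius := (le_add_right le_rfl).trans_lt ha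
  have hz' : (‖z‖₊ : ℝ≥0∞) < p.radius := (le_add_right le_rfl).trans_lt hz
  have hx : x ∈ Metric.eball (0 : E) (substSeries p a).radius := by
    refine mem_eball_zero_iff.2 (lt_of_lt_of_le ?_ (substSeries_radius p))
    rwa [lt_tsub_iff_right, add_comm]
  have h1 := ((substSeries p a).summable hx).hasSum.mapL π
  have h2 : ∀ m, π (substSeries p a m fun _ => x) =
      (p.changeOrigin ((0 : E), z) m fun _ => (x, 0)) • π 1 := by
    intro m
    have h3 := (hasSum_substSeries p ha' m fun _ => x).mapL π
    have h4 := (hasSum_partialCoeff p m (x := x) hz').smul_const (π 1)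
    refine h3.unique ?_
    convert h4 using 2 with l
    rw [map_smul, hπ, smul_smul, mul_comm]
  simp only [h2] at h1
  have hn : ‖((0 : E), z)‖₊ = ‖z‖₊ := by simp [Prod.nnnorm_def]
  have hn2 : ‖(x, (0 : ℂ))‖₊ = ‖x‖₊ := by simp [Prod.nnnorm_def]
  have h5 := p.changeOrigin_eval (x := ((0 : E), z)) (y := (x, 0)) (by rwa [hn, hn2])
  have hx2 : (x, (0 : ℂ)) ∈ Metric.eball (0 : E × ℂ) (p.changeOrigin ((0 : E), z)).radius := by
    refine mem_eball_zero_iff.2 (lt_of_lt_of_le ?_ p.changeOrigin_radius)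
    rw [lt_tsub_iff_right, add_comm, hn, enorm_eq_nnnorm, hn2]
    exact hz
  have h6 := ((p.changeOrigin ((0 : E), z)).summable hx2).hasSum.smul_const (π 1)
  have h7 := h1.unique h6
  change π ((substSeries p a).sum x) = (p.changeOrigin ((0 : E), z)).sum (x, 0) • π 1 at h7
  rw [h7, h5]
  simp

/-- At `x = 0` only the part of degree zero in `x` survives; its coefficients are those of `z ^ n`
by uniqueness of power series in one variable. -/
theorem substSeries_sum_zero (p : FormalMultilinearSeries ℂ (E × ℂ) ℂ) {a : A}
    (ha : (‖a‖₊ : ℝ≥0∞) < p.radius) {n : ℕ}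
    (hp : ∀ᶠ z : ℂ in 𝓝 0, p.sum ((0 : E), z) = z ^ n) :
    (substSeries p a).sum 0 = a ^ n := by
  have hr : 0 < p.radius := lt_of_le_of_lt (zero_le) ha
  set c : ℕ → ℂ := fun l => partialCoeff p 0 l fun _ => (0 : E) with hc
  have key : ∀ᶠ z : ℂ in 𝓝 0, HasSum (fun l => z ^ l • c l) (z ^ n) := by
    have hb : ∀ᶠ z : ℂ in 𝓝 0, (‖z‖₊ : ℝ≥0∞) < p.radius := by
      have : Metric.eball (0 : ℂ) p.radius ∈ 𝓝 0 := Metric.eball_mem_nhds _ hr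
      filter_upwards [this] with z hz
      simpa using! hz
    filter_upwards [hp, hb] with z hz hzr
    have h1 := hasSum_partialCoeff p 0 (x := 0) hzr
    have hn : ‖((0 : E), z)‖₊ = ‖z‖₊ := by simp [Prod.nnnorm_def]
    have h5 := p.changeOrigin_eval (x := ((0 : E), z)) (y := 0) (by simpa [hn] using hzr)
    rw [add_zero, hz] at h5
    rw [← h5]
    convert! h1 using 1
    rw [FormalMultilinearSeries.sum, tsum_eq_single 0]
    · congr 1
    · intro b hb
      obtain ⟨b, rfl⟩ := Nat.exists_eq_succ_of_ne_zero hb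
      exact ContinuousMultilinearMap.map_zero _
  have e1 : HasFPowerSeriesAt (fun z : ℂ => z ^ n) (FormalMultilinearSeries.ofScalars ℂ c) 0 := by
    rw [hasFPowerSeriesAt_iff]
    simpa [FormalMultilinearSeries.coeff_ofScalars] using! key
  have e2 : HasFPowerSeriesAt (fun z : ℂ => z ^ n)
      (FormalMultilinearSeries.ofScalars ℂ (Pi.single n (1 : ℂ))) 0 := by
    rw [hasFPowerSeriesAt_iff]
    refine Eventually.of_forall fun z => ?_
    simp only [FormalMultilinearSeries.coeff_ofScalars, zero_add]
    simpa [mul_comm] using hasSum_pi_single_smul n fun k => z ^ k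
  have e3 : c = Pi.single n (1 : ℂ) := by
    funext l
    have := congrArg (fun q : FormalMultilinearSeries ℂ ℂ ℂ => q.coeff l)
      (e1.eq_formalMultilinearSeries e2)
    simpa [FormalMultilinearSeries.coeff_ofScalars] using this
  rw [FormalMultilinearSeries.sum, tsum_eq_single 0]
  · refine (hasSum_substSeries p ha 0 _).unique ?_
    have : ∀ l, (partialCoeff p 0 l fun _ => (0 : E)) = (Pi.single n (1 : ℂ) : ℕ → ℂ) l :=
      fun l => congrFun e3 l
    simp only [this]
    exact hasSum_pi_single_smul n fun k => a ^ k
  · intro b hb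
    obtain ⟨b, rfl⟩ := Nat.exists_eq_succ_of_ne_zero hb
    exact ContinuousMultilinearMap.map_zero _

end OperatorValued

/-! ### Weierstrass division by an operator argument on bounded sequences. -/

section Weierstrass

/-- The right shift on bounded sequences. -/
noncomputable def rightShift : (ℕ →ᵇ ℂ) →L[ℂ] (ℕ →ᵇ ℂ) :=
  LinearMap.mkContinuous
    { toFun := fun f => BoundedContinuousFunction.ofNormedAddCommGroupDiscrete
        (fun n => Nat.casesOn n 0 f) ‖f‖ (by
          rintro (_ | n)
          · simp
          · exact f.norm_coe_le_norm n)
      map_add' := by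
        intro f g; ext (_ | n) <;> simp
      map_smul' := by
        intro c f; ext (_ | n) <;> simp } 1 (by
    intro f
    rw [one_mul, BoundedContinuousFunction.norm_le (norm_nonneg f)]
    rintro (_ | n)
    · simp
    · exact f.norm_coe_le_norm n)

/-- The left shift on bounded sequences. -/
noncomputable def leftShift : (ℕ →ᵇ ℂ) →L[ℂ] (ℕ →ᵇ ℂ) :=
  LinearMap.mkContinuous
    { toFun := fun f => f.compContinuous ⟨Nat.succ, continuous_of_discreteTopology⟩
      map_add' := fun _ _ => rfl
      map_smul' := fun _ _ => rfl } 1 (by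
    intro f
    rw [one_mul, BoundedContinuousFunction.norm_le (norm_nonneg f)]
    exact fun n => f.norm_coe_le_norm _)

theorem rightShift_zero (f : ℕ →ᵇ ℂ) : rightShift f 0 = 0 := rfl

theorem rightShift_succ (f : ℕ →ᵇ ℂ) (n : ℕ) : rightShift f (n + 1) = f n := rfl

theorem leftShift_apply (f : ℕ →ᵇ ℂ) (n : ℕ) : leftShift f n = f (n + 1) := rfl

theorem norm_rightShift_le : ‖rightShift‖ ≤ 1 := LinearMap.mkContinuous_norm_le _ zero_le_one _

/-- The Banach space of bounded sequences carries an operator `a` of small norm which models the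
multiplication of power series by the variable, with left inverse `L`. -/
theorem exists_small_shift {ρ : ℝ} (hρ : 0 < ρ) :
    ∃ (a L : (ℕ →ᵇ ℂ) →L[ℂ] (ℕ →ᵇ ℂ)) (c : (ℕ →ᵇ ℂ) →L[ℂ] ℂ) (e : ℕ →ᵇ ℂ),
      ‖a‖ ≤ ρ ∧ L * a = 1 ∧ a * L + c.smulRight e = 1 ∧ c.comp a = 0 ∧ L e = 0 ∧ c e = 1 := by
  have hρ' : (ρ : ℂ) ≠ 0 := by exact_mod_cast hρ.ne'
  set e : ℕ →ᵇ ℂ := BoundedContinuousFunction.ofNormedAddCommGroupDiscrete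
        (fun n => if n = 0 then (1 : ℂ) else 0) 1 (by intro n; split_ifs <;> simp) with he
  have he' : ∀ n, e n = if n = 0 then (1 : ℂ) else 0 := fun n => rfl
  -- A sequence `b` stands for `∑ b_k (z/ρ)^k`. Then `a` is multiplication by `z`, `L` is `b ↦ (b -
  -- b(0))/z`, `c` is the constant term and `e` is the constant `1`.
  refine ⟨(ρ : ℂ) • rightShift, (ρ : ℂ)⁻¹ • leftShift, BoundedContinuousFunction.evalCLM ℂ 0,
    e, ?_, ?_, ?_, ?_, ?_, ?_⟩
  · rw [norm_smul]
    have := norm_rightShift_le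
    simp only [Complex.norm_real, Real.norm_eq_abs, abs_of_pos hρ]
    nlinarith
  · ext f n
    simp [leftShift_apply, rightShift_succ, hρ']
  · ext f n
    rcases n with _ | n
    · simp [rightShift_zero, he']
    · simp [rightShift_succ, leftShift_apply, he', hρ']
  · ext f
    simp [rightShift_zero]
  · ext n
    simp [leftShift_apply, he']
  · simp [he']

variable {E : Type*} [NormedAddCommGroup E]

theorem eventually_nnnorm_add_lt {c : ℝ≥0} {R : ℝ≥0∞} (h : (c : ℝ≥0∞) < R) :
    ∀ᶠ x : E in 𝓝 0, ((c : ℝ≥0∞) + ‖x‖₊ : ℝ≥0∞) < R := by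
  have : ContinuousAt (fun x : E => (c : ℝ≥0∞) + ‖x‖₊) 0 := by fun_prop
  refine this.eventually_lt_const ?_
  simpa using h

variable [NormedSpace ℂ E]

theorem analyticAt_substSeries_sum {A : Type*} [NormedRing A] [NormedAlgebra ℂ A]
    [NormOneClass A] [CompleteSpace A]
    (p : FormalMultilinearSeries ℂ (E × ℂ) ℂ) {a : A}
    (ha : (‖a‖₊ : ℝ≥0∞) < p.radius) : AnalyticAt ℂ (substSeries p a).sum 0 :=
  ((substSeries p a).hasFPowerSeriesOnBall
    ((tsub_pos_of_lt ha).trans_le (substSeries_radius p))).analyticAt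

theorem eventually_sum_eq {f : E → ℂ} {p : FormalMultilinearSeries ℂ E ℂ}
    (hp : HasFPowerSeriesAt f p 0) : ∀ᶠ y in 𝓝 (0 : E), p.sum y = f y := by
  obtain ⟨r, hr⟩ := hp
  filter_upwards [Metric.eball_mem_nhds (0 : E) hr.r_pos] with y hy
  have := hr.sum hy
  rw [zero_add] at this
  exact this.symm

variable {B : Type*} [NormedAddCommGroup B] [NormedSpace ℂ B] [CompleteSpace B] [Nontrivial B]

theorem isUnit_eventually_of_continuousAt {A : Type*} [NormedRing A] [CompleteSpace A] {F : Type*}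
    [TopologicalSpace F] {M : F → A} {x : F} (hM : ContinuousAt M x) (h1 : M x = 1) :
    ∀ᶠ y in 𝓝 x, IsUnit (M y) := by
  have h2 : {b : A | IsUnit b} ∈ 𝓝 (M x) := Units.isOpen.mem_nhds (by rw [h1]; exact isUnit_one)
  exact hM.eventually h2

theorem analyticAt_ringInverse_comp {A : Type*} [NormedRing A] [NormedAlgebra ℂ A]
    [CompleteSpace A] {M : E → A} {x : E} (hM : AnalyticAt ℂ M x) (h1 : M x = 1) :
    AnalyticAt ℂ (fun y => Ring.inverse (M y)) x := by
  refine AnalyticAt.comp (g := Ring.inverse) ?_ hM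
  rw [h1]
  exact analyticAt_inverse (𝕜 := ℂ) (1 : Aˣ)

theorem analyticAt_clm_apply {F G : Type*} [NormedAddCommGroup F] [NormedSpace ℂ F]
    [NormedAddCommGroup G] [NormedSpace ℂ G] {u : E → F →L[ℂ] G} {v : E → F} {x : E}
    (hu : AnalyticAt ℂ u x) (hv : AnalyticAt ℂ v x) : AnalyticAt ℂ (fun y => u y (v y)) x :=
  AnalyticAt.fun_comp (f := fun y => (u y, v y)) (g := fun p : (F →L[ℂ] G) × F => p.1 p.2)
    ((ContinuousLinearMap.id ℂ (F →L[ℂ] G)).analyticAt_bilinear (u x, v x)) (hu.prod hv)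

/-- Weierstrass division, given a model of the multiplication by the variable. -/
theorem weierstrass_division_of_shift {f g : E × ℂ → ℂ} {n : ℕ}
    {p p' : FormalMultilinearSeries ℂ (E × ℂ) ℂ} (hp : HasFPowerSeriesAt f p 0)
    (hp' : HasFPowerSeriesAt g p' 0) (hn : ∀ᶠ z : ℂ in 𝓝 0, f (0, z) = z ^ n)
    (a L : B →L[ℂ] B) (c : B →L[ℂ] ℂ) (e : B)
    (hap : (‖a‖₊ : ℝ≥0∞) < p.radius) (hap' : (‖a‖₊ : ℝ≥0∞) < p'.radius)
    (hLa : L * a = 1) (haL : a * L + c.smulRight e = 1) (hca : c.comp a = 0)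
    (hLe : L e = 0) (hce : c e = 1) :
    ∃ (q : E × ℂ → ℂ) (r : ℕ → E → ℂ), AnalyticAt ℂ q 0 ∧ (∀ i, AnalyticAt ℂ (r i) 0) ∧
      ∀ᶠ y in 𝓝 (0 : E × ℂ), g y = q y * f y + ∑ i ∈ Finset.range n, r i y.1 * y.2 ^ i := by
  set T := (substSeries p a).sum with hT
  set T' := (substSeries p' a).sum with hT'
  have hTan : AnalyticAt ℂ T 0 := analyticAt_substSeries_sum p hap
  have hTan' : AnalyticAt ℂ T' 0 := analyticAt_substSeries_sum p' hap'
  have hT0 : T 0 = a ^ n := by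
    refine substSeries_sum_zero p hap ?_
    have h0 : Tendsto (fun z : ℂ => ((0 : E), z)) (𝓝 0) (𝓝 0) := by
      have : Continuous (fun z : ℂ => ((0 : E), z)) := by fun_prop
      exact this.tendsto' _ _ rfl
    filter_upwards [hn, h0.eventually (eventually_sum_eq hp)] with z h1 h2
    rw [h2, h1]
  -- Evaluation at `z`, written as the geometric series `∑ z^k c L^k` of Taylor coefficients.
  set ev : ℂ → B →L[ℂ] ℂ := fun z => c.comp (Ring.inverse (1 - z • L)) with hev
  have hunit : ∀ᶠ z : ℂ in 𝓝 0, IsUnit (1 - z • L) := by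
    refine isUnit_eventually_of_continuousAt ?_ (by simp)
    fun_prop
  have hevan : AnalyticAt ℂ ev 0 := by
    have h1 : AnalyticAt ℂ (fun z : ℂ => 1 - z • L) 0 := by fun_prop
    have h2 : AnalyticAt ℂ (fun z : ℂ => Ring.inverse (1 - z • L)) 0 :=
      analyticAt_ringInverse_comp h1 (by simp)
    exact ((ContinuousLinearMap.compL ℂ B B ℂ c).analyticAt _).comp h2
  have heva : ∀ z : ℂ, IsUnit (1 - z • L) → (ev z).comp a = z • ev z := by
    intro z hz
    have h1 : a = z • 1 + (1 - z • L) * a := by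
      rw [sub_mul, smul_mul_assoc, hLa]; simp
    have h2 : Ring.inverse (1 - z • L) * a = z • Ring.inverse (1 - z • L) + a := by
      conv_lhs => rw [h1]
      rw [mul_add, ← mul_assoc, Ring.inverse_mul_cancel _ hz]
      simp
    calc (ev z).comp a = c.comp (Ring.inverse (1 - z • L) * a) := rfl
      _ = z • ev z + c.comp a := by rw [h2]; ext; simp [hev]
      _ = z • ev z := by rw [hca, add_zero]
  have hevpow : ∀ z : ℂ, IsUnit (1 - z • L) → ∀ l, (ev z).comp (a ^ l) = z ^ l • ev z := by
    intro z hz l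
    induction l with
    | zero => ext; simp
    | succ l ih =>
      rw [pow_succ']
      calc (ev z).comp (a * a ^ l) = ((ev z).comp a).comp (a ^ l) := rfl
        _ = z ^ (l + 1) • ev z := by
          rw [heva z hz, ContinuousLinearMap.smul_comp, ih, smul_smul, pow_succ']
  have heve : ∀ z : ℂ, IsUnit (1 - z • L) → ev z e = 1 := by
    intro z hz
    have h1 : (1 - z • L) e = e := by simp [hLe]
    have h2 : Ring.inverse (1 - z • L) e = e := by
      conv_lhs => rw [← h1]
      rw [← mul_apply_eq_comp, Ring.inverse_mul_cancel _ hz]; rfl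
    simp [hev, h2, hce]
  -- `M x` sends `h` to `f(x, ·) * L^n h` plus the truncation of `h` below degree `n`. At `x = 0`
  -- the first factor is `z^n`, so it merely splits `h` into tail and truncation and is the
  -- identity.
  set M : E → B →L[ℂ] B := fun x =>
    T x * L ^ n + ∑ i ∈ Finset.range n, a ^ i * c.smulRight e * L ^ i with hM
  have hM0 : M 0 = 1 := by
    have key : ∀ k, a ^ k * L ^ k + ∑ i ∈ Finset.range k, a ^ i * c.smulRight e * L ^ i = 1 := by
      intro k
      induction k with
      | zero => simp
      | succ k ih =>
        rw [Finset.sum_range_succ]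
        have : c.smulRight e = 1 - a * L := by rw [← haL]; abel
        rw [this] at ih ⊢
        conv_rhs => rw [← ih]
        rw [pow_succ a, pow_succ' L]
        have e : a ^ k * (1 - a * L) * L ^ k = a ^ k * L ^ k - a ^ k * a * (L * L ^ k) := by
          noncomm_ring
        rw [e]
        abel
    simp only [hM, hT0]
    exact key n
  have hMan : AnalyticAt ℂ M 0 := by
    have := (hTan.mul (analyticAt_const (v := L ^ n))).add
      (analyticAt_const (v := ∑ i ∈ Finset.range n, a ^ i * c.smulRight e * L ^ i))
    exact this
  have hMinv : AnalyticAt ℂ (fun x => Ring.inverse (M x)) 0 :=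
    analyticAt_ringInverse_comp hMan hM0
  have hMunit : ∀ᶠ x in 𝓝 (0 : E), IsUnit (M x) :=
    isUnit_eventually_of_continuousAt hMan.continuousAt hM0
  -- Solving `M x h = g(x, ·)` performs the division: the quotient is `L^n h`, the remainder
  -- coefficients are the first `n` coefficients of `h`.
  set h : E → B := fun x => Ring.inverse (M x) (T' x e) with hh
  have hhan : AnalyticAt ℂ h 0 :=
    analyticAt_clm_apply hMinv (analyticAt_clm_apply hTan' analyticAt_const)
  have hfst : AnalyticAt ℂ (fun y : E × ℂ => y.1) 0 := analyticAt_fst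
  have hsnd : AnalyticAt ℂ (fun y : E × ℂ => y.2) 0 := analyticAt_snd
  refine ⟨fun y => ev y.2 ((L ^ n) (h y.1)), fun i x => c ((L ^ i) (h x)), ?_, ?_, ?_⟩
  · have h1 : AnalyticAt ℂ (fun y : E × ℂ => ev y.2) 0 := AnalyticAt.comp (g := ev) hevan hsnd
    have h2 : AnalyticAt ℂ (fun y : E × ℂ => h y.1) 0 := AnalyticAt.comp (g := h) hhan hfst
    exact analyticAt_clm_apply h1 (((L ^ n).analyticAt _).comp h2)
  · intro i
    exact ((c.comp (L ^ i)).analyticAt _).comp hhan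
  · have t1 : Tendsto (fun y : E × ℂ => y.1) (𝓝 0) (𝓝 0) := continuous_fst.tendsto' _ _ rfl
    have t2 : Tendsto (fun y : E × ℂ => y.2) (𝓝 0) (𝓝 0) := continuous_snd.tendsto' _ _ rfl
    have hsmall : ∀ R : ℝ≥0∞, 0 < R → ∀ᶠ y : E × ℂ in 𝓝 0, (‖y.2‖₊ + ‖y.1‖₊ : ℝ≥0∞) < R := by
      intro R hR
      have : ContinuousAt (fun y : E × ℂ => (‖y.2‖₊ + ‖y.1‖₊ : ℝ≥0∞)) 0 := by fun_prop
      refine this.eventually_lt_const ?_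
      simpa using hR
    filter_upwards [t1.eventually hMunit, t2.eventually hunit, eventually_sum_eq hp,
      eventually_sum_eq hp', t1.eventually (eventually_nnnorm_add_lt hap),
      t1.eventually (eventually_nnnorm_add_lt hap'), hsmall _ hp.radius_pos,
      hsmall _ hp'.radius_pos] with y hy1 hy2 hy3 hy4 hy5 hy6 hy7 hy8
    obtain ⟨x, z⟩ := y
    simp only at hy1 hy2 hy5 hy6 hy7 hy8 ⊢
    set π := ContinuousLinearMap.compL ℂ B B ℂ (ev z) with hπ
    have hπ1 : π 1 = ev z := by ext; simp [hπ]
    have hπpow : ∀ l, π (a ^ l) = z ^ l • π 1 := by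
      intro l
      rw [hπ1]
      exact hevpow z hy2 l
    have k1 := substSeries_sum_eval p π hπpow hy5 hy7
    have k2 := substSeries_sum_eval p' π hπpow hy6 hy8
    rw [hy3, hπ1] at k1
    rw [hy4, hπ1] at k2
    have k3 : M x (h x) = T' x e := by
      simp only [hh]
      rw [← mul_apply_eq_comp, Ring.mul_inverse_cancel _ hy1]; rfl
    have k4 := congrArg (ev z) k3
    have k5 : ev z (T' x e) = g (x, z) := by
      have := DFunLike.congr_fun k2 e
      simpa [heve z hy2] using! this
    have k6 : ∀ b, ev z (T x b) = f (x, z) * ev z b := fun b => by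
      simpa using! DFunLike.congr_fun k1 b
    have k7 : ∀ i b, ev z ((a ^ i) b) = z ^ i * ev z b := fun i b => by
      simpa using! DFunLike.congr_fun (hevpow z hy2 i) b
    rw [k5] at k4
    rw [← k4]
    simp only [hM, add_apply, mul_apply_eq_comp, map_add,
      sum_apply, map_sum, k6, k7, ContinuousLinearMap.smulRight_apply,
      map_smul, heve z hy2]
    congr 1
    · ring
    · refine Finset.sum_congr rfl fun i _ => ?_
      simp [mul_comm]

/-- Weierstrass division by a function whose restriction to the last axis is a power. -/
theorem weierstrass_division_of_pow {f g : E × ℂ → ℂ} {n : ℕ} (hf : AnalyticAt ℂ f 0)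
    (hg : AnalyticAt ℂ g 0) (hn : ∀ᶠ z : ℂ in 𝓝 0, f (0, z) = z ^ n) :
    ∃ (q : E × ℂ → ℂ) (r : ℕ → E → ℂ), AnalyticAt ℂ q 0 ∧ (∀ i, AnalyticAt ℂ (r i) 0) ∧
      ∀ᶠ y in 𝓝 (0 : E × ℂ), g y = q y * f y + ∑ i ∈ Finset.range n, r i y.1 * y.2 ^ i := by
  obtain ⟨p, hp⟩ := hf
  obtain ⟨p', hp'⟩ := hg
  obtain ⟨ρ, hρ, hρp⟩ : ∃ ρ : ℝ≥0, 0 < ρ ∧ (ρ : ℝ≥0∞) < min p.radius p'.radius := by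
    obtain ⟨ρ, h1, h2⟩ := ENNReal.lt_iff_exists_nnreal_btwn.1
      (lt_min hp.radius_pos hp'.radius_pos)
    exact ⟨ρ, by exact_mod_cast h1, h2⟩
  obtain ⟨a, L, c, e, ha, hLa, haL, hca, hLe, hce⟩ := exists_small_shift (ρ := ρ) hρ
  have ha' : (‖a‖₊ : ℝ≥0∞) ≤ ρ := by exact_mod_cast ha
  have hap : (‖a‖₊ : ℝ≥0∞) < p.radius := ha'.trans_lt (hρp.trans_le (min_le_left _ _))
  have hap' : (‖a‖₊ : ℝ≥0∞) < p'.radius := ha'.trans_lt (hρp.trans_le (min_le_right _ _))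
  have : Nontrivial (ℕ →ᵇ ℂ) := ⟨e, 0, fun h => by simp [h] at hce⟩
  exact weierstrass_division_of_shift hp hp' hn a L c e hap hap' hLa haL hca hLe hce

/-- Weierstrass division. -/
theorem weierstrass_division {f g : E × ℂ → ℂ} {u : ℂ → ℂ} {n : ℕ} (hf : AnalyticAt ℂ f 0)
    (hu : AnalyticAt ℂ u 0) (hu0 : u 0 ≠ 0) (hn : ∀ᶠ z : ℂ in 𝓝 0, f (0, z) = z ^ n * u z)
    (hg : AnalyticAt ℂ g 0) :
    ∃ (q : E × ℂ → ℂ) (r : ℕ → E → ℂ), AnalyticAt ℂ q 0 ∧ (∀ i, AnalyticAt ℂ (r i) 0) ∧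
      ∀ᶠ y in 𝓝 (0 : E × ℂ), g y = q y * f y + ∑ i ∈ Finset.range n, r i y.1 * y.2 ^ i := by
  have hsnd : AnalyticAt ℂ (fun y : E × ℂ => y.2) 0 := analyticAt_snd
  have hu' : AnalyticAt ℂ (fun y : E × ℂ => (u y.2)⁻¹) 0 :=
    (AnalyticAt.fun_comp (f := fun y : E × ℂ => y.2) (g := u) hu hsnd).inv hu0
  have hf' : AnalyticAt ℂ (fun y => (u y.2)⁻¹ * f y) 0 := hu'.mul hf
  have hune : ∀ᶠ z in 𝓝 (0 : ℂ), u z ≠ 0 := hu.continuousAt.eventually_ne hu0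
  obtain ⟨q, r, hq, hr, h⟩ := weierstrass_division_of_pow hf' hg (n := n) (by
    filter_upwards [hn, hune] with z h1 h2
    rw [h1]; field_simp)
  refine ⟨fun y => q y * (u y.2)⁻¹, r, hq.mul hu', hr, ?_⟩
  filter_upwards [h] with y hy
  rw [hy, mul_assoc]

end Weierstrass

/-! ### Analytic functions, their germs and pullbacks. -/

section Germs

/-- Functions on `ℂ^d` which are analytic at the origin. -/
noncomputable def AnFun (d : ℕ) : Subalgebra ℂ (Cd d → ℂ) where
  carrier := {f | AnalyticAt ℂ f 0}
  mul_mem' hf hg := AnalyticAt.mul hf hg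
  add_mem' hf hg := AnalyticAt.add hf hg
  algebraMap_mem' c := analyticAt_const (v := c)

variable {d d' : ℕ}

/-- The germ at the origin of an analytic function. -/
noncomputable def toGerm (d : ℕ) : AnFun d →ₐ[ℂ] HolGerm d where
  toFun f := ⟨((f : Cd d → ℂ) : Germ (𝓝 (0 : Cd d)) ℂ), f, f.2, rfl⟩
  map_one' := rfl
  map_mul' _ _ := rfl
  map_zero' := rfl
  map_add' _ _ := rfl
  commutes' _ := rfl

theorem toGerm_surjective (d : ℕ) : Function.Surjective (toGerm d) := by
  rintro ⟨_, f, hf, rfl⟩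
  exact ⟨⟨f, hf⟩, rfl⟩

theorem toGerm_eq_iff {f g : AnFun d} :
    toGerm d f = toGerm d g ↔ ∀ᶠ x in 𝓝 (0 : Cd d), (f : Cd d → ℂ) x = (g : Cd d → ℂ) x := by
  rw [Subtype.ext_iff]
  exact Germ.coe_eq

/-- The pullback of analytic functions under an analytic map fixing the origin. -/
noncomputable def AnFun.pullback (π : Cd d' → Cd d) (hπ : AnalyticAt ℂ π 0) (h0 : π 0 = 0) :
    AnFun d →ₐ[ℂ] AnFun d' where
  toFun f := ⟨fun x => (f : Cd d → ℂ) (π x),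
    AnalyticAt.fun_comp (g := (f : Cd d → ℂ)) (by rw [h0]; exact f.2) hπ⟩
  map_one' := rfl
  map_mul' _ _ := rfl
  map_zero' := rfl
  map_add' _ _ := rfl
  commutes' _ := rfl

/-- Evaluation of analytic functions at a point. -/
noncomputable def AnFun.eval (x : Cd d) : AnFun d →ₐ[ℂ] ℂ :=
  (Pi.evalAlgHom ℂ (fun _ : Cd d => ℂ) x).comp (AnFun d).val

theorem AnFun.eval_apply (x : Cd d) (f : AnFun d) : AnFun.eval x f = (f : Cd d → ℂ) x := rfl

/-- The pullback of germs of analytic functions under an analytic map fixing the origin. -/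
noncomputable def germPullback (π : Cd d' → Cd d) (hπ : AnalyticAt ℂ π 0) (h0 : π 0 = 0) :
    HolGerm d →ₐ[ℂ] HolGerm d' where
  toFun φ := ⟨φ.1.compTendsto π (by simpa [ContinuousAt, h0] using hπ.continuousAt), by
    obtain ⟨_, f, hf, rfl⟩ := φ
    exact ⟨f ∘ π, AnalyticAt.comp (by rwa [h0]) hπ, rfl⟩⟩
  map_one' := rfl
  map_mul' := by
    rintro ⟨_, f, hf, rfl⟩ ⟨_, g, hg, rfl⟩
    rfl
  map_zero' := rfl
  map_add' := by
    rintro ⟨_, f, hf, rfl⟩ ⟨_, g, hg, rfl⟩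
    rfl
  commutes' _ := rfl

theorem germPullback_toGerm (π : Cd d' → Cd d) (hπ : AnalyticAt ℂ π 0) (h0 : π 0 = 0)
    (f : AnFun d) : germPullback π hπ h0 (toGerm d f) = toGerm d' (AnFun.pullback π hπ h0 f) := rfl

end Germs

/-! ### Weierstrass division in suitable linear coordinates. -/

section Division

/-- Otherwise the identity theorem, applied on the slice of a ball of analyticity by each complex
line through the origin, makes `h` vanish on the whole ball. -/
theorem exists_line_of_not_eventually_zero {E : Type*} [NormedAddCommGroup E]
    [Nontrivial E] [NormedSpace ℂ E] {h : E → ℂ} (hh : AnalyticAt ℂ h 0) (h0 : ¬ ∀ᶠ x in 𝓝 (0 : E), h x = 0) :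
    ∃ v : E, v ≠ 0 ∧ ¬ ∀ᶠ t in 𝓝 (0 : ℂ), h (t • v) = 0 := by
  by_contra! H
  apply h0
  obtain ⟨r, hr, hb⟩ := hh.exists_ball_analyticOnNhd
  filter_upwards [Metric.ball_mem_nhds (0 : E) hr] with x hx
  rcases eq_or_ne x 0 with rfl | hx0
  · obtain ⟨v, hv⟩ := exists_ne (0 : E)
    simpa using (H v hv).self_of_nhds
  set l : ℂ →L[ℂ] E := ContinuousLinearMap.toSpanSingleton ℂ x with hl
  have hU : Convex ℝ (l ⁻¹' Metric.ball 0 r) :=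
    (convex_ball (0 : E) r).is_linear_preimage
      ⟨fun a b => map_add l a b, fun c a => by simp [hl, mul_smul]⟩
  have han : AnalyticOnNhd ℂ (fun t => h (l t)) (l ⁻¹' Metric.ball 0 r) := fun t ht =>
    AnalyticAt.fun_comp (hb _ ht) (l.analyticAt t)
  have := han.eqOn_zero_of_preconnected_of_eventuallyEq_zero hU.isPreconnected (z₀ := 0)
    (by simpa using hr) (H x hx0)
  have h1 := this (x := 1) (by simpa [hl] using hx)
  simpa [hl] using! h1

theorem exists_equiv_prod_apply_eq {d : ℕ} {v : Cd (d + 1)} (hv : v ≠ 0) :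
    ∃ e : Cd (d + 1) ≃L[ℂ] Cd d × ℂ, e v = (0, 1) := by
  have e₀ : Cd (d + 1) ≃L[ℂ] Cd d × ℂ := ContinuousLinearEquiv.ofFinrankEq (by simp)
  have h1 : e₀ v ≠ 0 := by simpa using hv
  obtain ⟨A, hA⟩ := SeparatingDual.exists_continuousLinearEquiv_apply_eq (R := ℂ) h1
    (y := ((0 : Cd d), (1 : ℂ))) (by simp)
  exact ⟨e₀.trans A, hA⟩

/-- Weierstrass division by a nonzero analytic function in suitable linear coordinates. -/
theorem exists_division_coordinates {d : ℕ} {h : Cd (d + 1) → ℂ} (hh : AnalyticAt ℂ h 0)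
    (h0 : ¬ ∀ᶠ x in 𝓝 (0 : Cd (d + 1)), h x = 0) :
    ∃ (e : Cd (d + 1) ≃L[ℂ] Cd d × ℂ) (n : ℕ) (u : ℂ → ℂ), AnalyticAt ℂ u 0 ∧ u 0 ≠ 0 ∧
      (∀ᶠ z in 𝓝 (0 : ℂ), h (e.symm (0, z)) = z ^ n * u z) ∧
      ∀ g : Cd (d + 1) → ℂ, AnalyticAt ℂ g 0 →
        ∃ (q : Cd (d + 1) → ℂ) (r : ℕ → Cd d → ℂ), AnalyticAt ℂ q 0 ∧
          (∀ i, AnalyticAt ℂ (r i) 0) ∧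
          ∀ᶠ x in 𝓝 0, g x = q x * h x + ∑ i ∈ Finset.range n, r i (e x).1 * (e x).2 ^ i := by
  obtain ⟨v, hv0, hv⟩ := exists_line_of_not_eventually_zero hh h0
  obtain ⟨e, he⟩ := exists_equiv_prod_apply_eq hv0
  have hes : ∀ z : ℂ, e.symm (0, z) = z • v := by
    intro z
    rw [e.symm_apply_eq, map_smul, he]
    simp
  have hline : AnalyticAt ℂ (fun z : ℂ => h (z • v)) 0 := by
    refine AnalyticAt.fun_comp (g := h) (f := fun z : ℂ => z • v) ?_ (by fun_prop)
    simpa using hh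
  obtain ⟨n, u, hu, hu0, hnu⟩ := hline.exists_eventuallyEq_pow_smul_nonzero_iff.2 hv
  simp only [sub_zero, smul_eq_mul] at hnu
  have hes_an : AnalyticAt ℂ (fun y : Cd d × ℂ => e.symm y) 0 :=
    (e.symm : Cd d × ℂ →L[ℂ] Cd (d + 1)).analyticAt 0
  have he_an : AnalyticAt ℂ (fun y => e y) 0 :=
    (e : Cd (d + 1) →L[ℂ] Cd d × ℂ).analyticAt 0
  have hcomp : ∀ g : Cd (d + 1) → ℂ, AnalyticAt ℂ g 0 →
      AnalyticAt ℂ (fun y : Cd d × ℂ => g (e.symm y)) 0 := fun g hg =>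
    AnalyticAt.fun_comp (g := g) (by simpa using hg) hes_an
  refine ⟨e, n, u, hu, hu0, by simpa only [hes] using hnu, fun g hg => ?_⟩
  obtain ⟨q, r, hq, hr, hqr⟩ := weierstrass_division (hcomp h hh) hu hu0
    (by simpa only [hes] using hnu) (hcomp g hg)
  refine ⟨fun x => q (e x), r, AnalyticAt.fun_comp (g := q) (by simpa using hq) he_an, hr, ?_⟩
  have ht : Tendsto (fun x => e x) (𝓝 0) (𝓝 0) := by
    simpa using e.continuous.tendsto 0
  filter_upwards [ht.eventually hqr] with x hx
  simpa using hx

/-- Let `z → 0` to kill the constant coefficient, divide by `z`, and induct. Comparing a division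
identity on the last axis this way gives the preparation theorem. -/
theorem coeff_eq_zero_of_eventually_eq_pow_mul {n : ℕ} {r : ℕ → ℂ} {v : ℂ → ℂ}
    (hv : ContinuousAt v 0)
    (h : ∀ᶠ z in 𝓝[≠] (0 : ℂ), ∑ i ∈ Finset.range n, r i * z ^ i = z ^ n * v z) :
    (∀ i < n, r i = 0) ∧ v 0 = 0 := by
  have hv' : Tendsto v (𝓝[≠] 0) (𝓝 (v 0)) := hv.tendsto.mono_left nhdsWithin_le_nhds
  induction n generalizing r with
  | zero =>
    refine ⟨by simp, ?_⟩
    refine tendsto_nhds_unique hv' (tendsto_const_nhds.congr' ?_)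
    filter_upwards [h] with z hz
    simpa using hz
  | succ n ih =>
    have h1 : Tendsto (fun z : ℂ => ∑ i ∈ Finset.range (n + 1), r i * z ^ i) (𝓝[≠] 0)
        (𝓝 (r 0)) := by
      have : Continuous (fun z : ℂ => ∑ i ∈ Finset.range (n + 1), r i * z ^ i) := by fun_prop
      have h2 := (this.tendsto 0).mono_left (nhdsWithin_le_nhds (s := {0}ᶜ))
      convert! h2 using 2
      rw [Finset.sum_range_succ']
      simp
    have h2 : Tendsto (fun z : ℂ => z ^ (n + 1) * v z) (𝓝[≠] 0) (𝓝 0) := by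
      have h3 : Tendsto (fun z : ℂ => z ^ (n + 1)) (𝓝[≠] 0) (𝓝 0) := by
        have : Continuous (fun z : ℂ => z ^ (n + 1)) := by fun_prop
        simpa using (this.tendsto 0).mono_left (nhdsWithin_le_nhds (s := {0}ᶜ))
      simpa using h3.mul hv'
    have hr0 : r 0 = 0 := tendsto_nhds_unique (h1.congr' h) h2
    obtain ⟨k1, k2⟩ := ih (r := fun i => r (i + 1)) (by
      filter_upwards [h, self_mem_nhdsWithin] with z hz hz0
      rw [Finset.sum_range_succ', hr0] at hz
      have hz0' : z ≠ 0 := hz0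
      apply mul_left_cancel₀ hz0'
      rw [Finset.mul_sum]
      calc _ = ∑ i ∈ Finset.range n, r (i + 1) * z ^ (i + 1) + 0 * z ^ 0 := by
            rw [zero_mul, add_zero]
            exact Finset.sum_congr rfl fun i _ => by ring
        _ = _ := by rw [hz]; ring)
    refine ⟨fun i hi => ?_, k2⟩
    rcases i with _ | i
    · exact hr0
    · exact k1 i (by omega)

/-- If `‖z‖ ≥ δ`, each of the `n` terms is at most `‖z‖^n / (n + 1)`, so their sum cannot reach
`‖z‖^n`. It keeps the roots of a Weierstrass polynomial inside the domain of the division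
identities. -/
theorem norm_lt_of_pow_eq_sum {n : ℕ} {δ : ℝ} (hδ : 0 < δ) (hδ1 : δ ≤ 1) {c : ℕ → ℂ} {z : ℂ}
    (hc : ∀ i < n, ‖c i‖ < δ ^ n / (n + 1)) (h : z ^ n = ∑ i ∈ Finset.range n, c i * z ^ i) :
    ‖z‖ < δ := by
  by_contra! hz
  have hz0 : 0 < ‖z‖ := hδ.trans_le hz
  have h1 : ‖z‖ ^ n ≤ ∑ i ∈ Finset.range n, ‖z‖ ^ n / (n + 1) := by
    rw [← norm_pow, h]
    refine (norm_sum_le _ _).trans (Finset.sum_le_sum fun i hi => ?_)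
    rw [← h, norm_mul, norm_pow, norm_pow]
    have hi' := Finset.mem_range.1 hi
    have h2 : δ ^ n ≤ ‖z‖ ^ (n - i) := calc
      δ ^ n ≤ δ ^ (n - i) := pow_le_pow_of_le_one hδ.le hδ1 (Nat.sub_le _ _)
      _ ≤ _ := by gcongr
    calc ‖c i‖ * ‖z‖ ^ i ≤ (‖z‖ ^ (n - i) / (n + 1)) * ‖z‖ ^ i := by
          gcongr
          exact (hc i hi').le.trans (by gcongr)
      _ = ‖z‖ ^ n / (n + 1) := by
          rw [div_mul_eq_mul_div, ← pow_add, Nat.sub_add_cancel hi'.le]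
  rw [Finset.sum_const, Finset.card_range, nsmul_eq_mul, mul_div_assoc',
    le_div_iff₀ (by positivity)] at h1
  have : 0 < ‖z‖ ^ n := by positivity
  nlinarith

end Division

/-! ### Elimination of one variable by resultants. -/

section Elimination

open Polynomial

/-- If the resultants of a monic polynomial with sufficiently many linear combinations of given
polynomials vanish, then all of these polynomials have a common root. -/
theorem exists_common_root_of_resultant_eq_zero {K : Type*} [Field K] [IsAlgClosed K] [CharZero K]
    {n s : ℕ} {w : K[X]} (hw : w.Monic) (hn : w.natDegree = n) (H : Fin s → K[X])
    (hH : ∀ j, (H j).natDegree ≤ n)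
    (hres : ∀ c : Fin (n * s + 1),
      resultant w (∑ j : Fin s, C ((c : K) ^ (j : ℕ)) * H j) n (n + 1) = 0) :
    ∃ z, w.eval z = 0 ∧ ∀ j, (H j).eval z = 0 := by
  -- `P` evaluated at `c` is the product, over the roots `z` of `w`, of the values `∑ H_j(z) c^j`.
  -- It vanishes at `n * s + 1` points but has degree at most `n * s`, so it is zero and some factor
  -- `Q z` has all its coefficients `H_j(z)` equal to zero.
  set Q : K → K[X] := fun z => ∑ j : Fin s, C ((H j).eval z) * X ^ (j : ℕ) with hQ
  set P : K[X] := (w.roots.map Q).prod with hP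
  have hQdeg : ∀ z, (Q z).natDegree ≤ s := fun z =>
    natDegree_sum_le_of_forall_le _ _ fun j _ => (natDegree_C_mul_X_pow_le _ _).trans j.2.le
  have hPdeg : P.natDegree ≤ n * s := by
    refine (natDegree_multiset_prod_le _).trans ?_
    have h1 := Multiset.sum_le_card_nsmul ((w.roots.map Q).map natDegree) s (by
      intro x hx
      simp only [Multiset.mem_map] at hx
      obtain ⟨_, ⟨z, _, rfl⟩, rfl⟩ := hx
      exact hQdeg z)
    refine h1.trans ?_
    rw [Multiset.card_map, Multiset.card_map, smul_eq_mul]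
    exact Nat.mul_le_mul_right _ (hn ▸ card_roots' w)
  have hP0 : P = 0 := by
    refine eq_zero_of_natDegree_lt_card_of_eval_eq_zero P
      (f := fun c : Fin (n * s + 1) => ((c : ℕ) : K)) ?_ ?_ (by simpa using Nat.lt_succ_of_le hPdeg)
    · intro a b hab
      exact Fin.ext (Nat.cast_injective hab)
    · intro c
      set h := ∑ j : Fin s, C (((c : ℕ) : K) ^ (j : ℕ)) * H j with hh
      have hdeg : h.natDegree ≤ n := natDegree_sum_le_of_forall_le _ _ fun j _ =>
        (natDegree_C_mul_le _ _).trans (hH j)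
      have h1 : resultant w h = 0 := by
        -- Raising the formal degree only multiplies the resultant by powers of the leading
        -- coefficient of `w`, which is `1`.
        have h2 := resultant_add_right_deg w h n h.natDegree (n + 1 - h.natDegree) le_rfl
        rw [Nat.add_sub_cancel' (by omega), hres c, ← hn, hw.coeff_natDegree, one_pow,
          one_mul] at h2
        exact h2.symm
      have h2 := (resultant_eq_zero_iff.1 h1).2
      rw [isCoprime_iff_aeval_ne_zero_of_isAlgClosed K K] at h2
      push Not at h2
      obtain ⟨z, hz1, hz2⟩ := h2
      rw [hP, eval_multiset_prod, Multiset.map_map]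
      refine Multiset.prod_eq_zero (Multiset.mem_map.2 ⟨z, ?_, ?_⟩)
      · rw [mem_roots hw.ne_zero]
        simpa using! hz1
      · rw [hh] at hz2
        simp only [map_sum, map_mul, aeval_C, coe_aeval_eq_eval] at hz2
        simp only [Function.comp, hQ, eval_finsetSum, eval_mul, eval_C, eval_pow, eval_X]
        rw [← hz2]
        refine Finset.sum_congr rfl fun j _ => ?_
        simp [mul_comm]
  rw [hP, Multiset.prod_eq_zero_iff] at hP0
  obtain ⟨z, hz, hQz⟩ := Multiset.mem_map.1 hP0
  refine ⟨z, (mem_roots'.1 hz).2, fun j => ?_⟩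
  have := congrArg (fun q => q.coeff (j : ℕ)) hQz
  simp only [hQ, finsetSum_coeff, coeff_C_mul, coeff_X_pow, coeff_zero] at this
  rw [Finset.sum_eq_single j] at this
  · simpa using this
  · intro i _ hij
    simp [Fin.val_injective.ne hij.symm]
  · simp

end Elimination

/-! ### Finite codimension of ideals with an isolated zero. -/

section Nullstellensatz

open Polynomial

theorem finite_quotient_zero (I : Ideal (HolGerm 0)) : Module.Finite ℂ (HolGerm 0 ⧸ I) := by
  refine Module.Finite.of_surjective (Algebra.linearMap ℂ (HolGerm 0 ⧸ I)) ?_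
  intro y
  obtain ⟨y, rfl⟩ := Ideal.Quotient.mk_surjective y
  obtain ⟨f, rfl⟩ := toGerm_surjective 0 y
  refine ⟨(f : Cd 0 → ℂ) 0, ?_⟩
  change Ideal.Quotient.mk I (algebraMap ℂ (HolGerm 0) ((f : Cd 0 → ℂ) 0)) = _
  congr 1
  rw [← (toGerm 0).commutes, toGerm_eq_iff]
  exact Eventually.of_forall fun x => by rw [Subsingleton.elim x 0]; rfl

/-- If `S` is generated by finitely many elements as a module over the image of `R` modulo `K`, and
`R` is finite over `k` modulo an ideal mapped into `K`, then so is `S` modulo `K`. -/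
theorem finite_quotient_of_generators {k R S : Type*} [Field k] [CommRing R] [Algebra k R]
    [CommRing S] [Algebra k S] (φ : R →ₐ[k] S) (I : Ideal R) (K : Ideal S)
    (hIK : ∀ a ∈ I, φ a ∈ K) [Module.Finite k (R ⧸ I)] {n : ℕ} (z : Fin n → S)
    (hz : ∀ y, ∃ a : Fin n → R, y - ∑ i, φ (a i) * z i ∈ K) : Module.Finite k (S ⧸ K) := by
  let ψ : R ⧸ I →ₐ[k] S ⧸ K := Ideal.Quotient.liftₐ I ((Ideal.Quotient.mkₐ k K).comp φ)
    fun a ha => Ideal.Quotient.eq_zero_iff_mem.2 (hIK a ha)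
  let F : (Fin n → R ⧸ I) →ₗ[k] S ⧸ K :=
    ∑ i, (LinearMap.mulRight k (Ideal.Quotient.mk K (z i))).comp
      (ψ.toLinearMap.comp (LinearMap.proj i))
  refine Module.Finite.of_surjective F fun y => ?_
  obtain ⟨y, rfl⟩ := Ideal.Quotient.mk_surjective y
  obtain ⟨a, ha⟩ := hz y
  refine ⟨fun i => Ideal.Quotient.mk I (a i), ?_⟩
  rw [← Ideal.Quotient.eq] at ha
  rw [ha, map_sum]
  simp only [F, LinearMap.sum_apply]
  refine Finset.sum_congr rfl fun i _ => ?_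
  rw [map_mul]
  rfl

variable {d : ℕ} (e : Cd (d + 1) ≃L[ℂ] Cd d × ℂ)

/-- The projection along the last of the coordinates `e`. -/
noncomputable def coordProj : Cd (d + 1) → Cd d := fun x => (e x).1

theorem analyticAt_coordProj : AnalyticAt ℂ (coordProj e) 0 :=
  analyticAt_fst.comp ((e : Cd (d + 1) →L[ℂ] Cd d × ℂ).analyticAt 0)

theorem coordProj_zero : coordProj e 0 = 0 := by simp [coordProj]

/-- The last of the coordinates `e`. -/
noncomputable def coordLast : AnFun (d + 1) :=
  ⟨fun x => (e x).2, analyticAt_snd.comp ((e : Cd (d + 1) →L[ℂ] Cd d × ℂ).analyticAt 0)⟩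

/-- Polynomials in the last coordinate as analytic functions. -/
noncomputable def polyToAnFun : (AnFun d)[X] →+* AnFun (d + 1) :=
  eval₂RingHom (AnFun.pullback (coordProj e) (analyticAt_coordProj e) (coordProj_zero e)).toRingHom
    (coordLast e)

theorem polyToAnFun_C (a : AnFun d) : polyToAnFun e (C a) =
    AnFun.pullback (coordProj e) (analyticAt_coordProj e) (coordProj_zero e) a :=
  eval₂_C _ _

theorem polyToAnFun_apply (p : (AnFun d)[X]) (x : Cd (d + 1)) :
    (polyToAnFun e p : Cd (d + 1) → ℂ) x =
      (p.map (AnFun.eval (e x).1).toRingHom).eval (e x).2 := by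
  rw [eval_map]
  exact hom_eval₂ p _ (AnFun.eval x).toRingHom _

theorem eval_sum_range_C_mul_X_pow {n : ℕ} (R : ℕ → AnFun d) (x : Cd d) (z : ℂ) :
    ((∑ i ∈ Finset.range n, C (R i) * X ^ i).map (AnFun.eval x).toRingHom).eval z =
      ∑ i ∈ Finset.range n, (R i : Cd d → ℂ) x * z ^ i := by
  simp only [Polynomial.map_sum, Polynomial.map_mul, map_C, Polynomial.map_pow, map_X,
    eval_finsetSum, eval_mul, eval_C, eval_pow, eval_X]
  rfl

theorem degree_sum_range_C_mul_X_pow_lt {R : Type*} [CommRing R] {n : ℕ} (c : ℕ → R) :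
    (∑ i ∈ Finset.range n, C (c i) * X ^ i : R[X]).degree < (n : WithBot ℕ) := by
  rw [← mem_degreeLT]
  refine Submodule.sum_mem _ fun i hi => mem_degreeLT.2 ?_
  exact (degree_C_mul_X_pow_le _ _).trans_lt (by exact_mod_cast Finset.mem_range.1 hi)

/-- The resultant is a polynomial combination of `w` and `h`. The second formal degree is `n + 1`
rather than `n` so that this Bézout identity is available also for `n = 0`. -/
theorem resultant_mem_of_mem {R S : Type*} [CommRing R] [CommRing S] (Θ : R[X] →+* S)
    (K : Ideal S) {w h : R[X]} {n : ℕ} (hw : w.natDegree ≤ n) (hh : h.natDegree ≤ n)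
    (hwK : Θ w ∈ K) (hhK : Θ h ∈ K) : Θ (C (resultant w h n (n + 1))) ∈ K := by
  obtain ⟨p, q, -, -, hpq⟩ := exists_mul_add_mul_eq_C_resultant (m := n) (n := n + 1) w h hw
    (hh.trans (Nat.le_succ n)) (Or.inr (Nat.succ_ne_zero n))
  rw [← hpq, map_add, map_mul, map_mul]
  exact K.add_mem (K.mul_mem_right _ hwK) (K.mul_mem_right _ hhK)

/-- Local analytic Nullstellensatz for isolated zeros: if the origin is an isolated common zero of
finitely many analytic functions (or not a common zero at all), then the ideal generated by their
germs has finite codimension. -/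
theorem finite_quotient_of_isolated (d : ℕ) : ∀ {s : ℕ} (h : Fin s → AnFun d),
    (∀ᶠ x in 𝓝 (0 : Cd d), (∀ i, (h i : Cd d → ℂ) x = 0) → x = 0) →
    Module.Finite ℂ (HolGerm d ⧸ Ideal.span (Set.range fun i => toGerm d (h i))) := by
  induction d with
  | zero => exact fun _ _ => finite_quotient_zero _
  | succ d ih =>
  intro s h hiso
  obtain ⟨i₀, hi₀⟩ : ∃ i, ¬ ∀ᶠ x in 𝓝 (0 : Cd (d + 1)), (h i : Cd (d + 1) → ℂ) x = 0 := by
    by_contra! H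
    have h1 : ∀ᶠ x in 𝓝 (0 : Cd (d + 1)), x = 0 := by
      filter_upwards [hiso, eventually_all.2 H] with x h1 h2 using h1 h2
    obtain ⟨x, hx1, hx2⟩ := ((h1.filter_mono (nhdsWithin_le_nhds (s := {0}ᶜ))).and
      self_mem_nhdsWithin).exists
    exact hx2 hx1
  obtain ⟨e, n, u, hu, hu0, hnu, hdiv⟩ := exists_division_coordinates (h i₀).2 hi₀
  set f : AnFun (d + 1) := h i₀ with hf
  set K : Ideal (HolGerm (d + 1)) := Ideal.span (Set.range fun i => toGerm (d + 1) (h i)) with hK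
  have hhK : ∀ i, toGerm (d + 1) (h i) ∈ K := fun i => Ideal.subset_span ⟨i, rfl⟩
  -- Dividing the `n`-th power of the last coordinate by `f` yields the Weierstrass polynomial of
  -- `f`; the remainders of the `h j` represent them modulo `f`.
  obtain ⟨q₀, r₀, hq₀, hr₀, hqr₀⟩ := hdiv (fun x => (e x).2 ^ n) ((coordLast e).2.pow n)
  choose q r hq hr hqr using fun j => hdiv (h j) (h j).2
  have hsymm : Tendsto (fun z : ℂ => e.symm (0, z)) (𝓝 0) (𝓝 0) := by
    have : Continuous (fun z : ℂ => e.symm ((0 : Cd d), z)) := by fun_prop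
    exact this.tendsto' _ _ (map_zero e.symm)
  -- On the last axis `f` is `z^n u`, so the identity reads `∑ r₀ i 0 * z^i = z^n (1 - q₀ u)`: the
  -- lower coefficients of the Weierstrass polynomial vanish at the origin and `q₀` is a unit.
  have hcoef : (∀ i < n, r₀ i 0 = 0) ∧ 1 - q₀ (e.symm (0, 0)) * u 0 = 0 := by
    refine coeff_eq_zero_of_eventually_eq_pow_mul (n := n) (r := fun i => r₀ i 0)
      (v := fun z => 1 - q₀ (e.symm (0, z)) * u z) ?_ ?_
    · have h1 : ContinuousAt (fun z : ℂ => q₀ (e.symm (0, z))) 0 := by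
        have h2 : ContinuousAt q₀ (e.symm ((0 : Cd d), (0 : ℂ))) := by
          have : e.symm ((0 : Cd d), (0 : ℂ)) = 0 := map_zero e.symm
          rw [this]
          exact hq₀.continuousAt
        have h3 : ContinuousAt (fun z : ℂ => e.symm ((0 : Cd d), z)) 0 := by fun_prop
        exact ContinuousAt.comp (g := q₀) h2 h3
      exact continuousAt_const.sub (h1.mul hu.continuousAt)
    · refine Filter.Eventually.filter_mono nhdsWithin_le_nhds ?_
      filter_upwards [hsymm.eventually hqr₀, hnu] with z h1 h2
      simp only [ContinuousLinearEquiv.apply_symm_apply] at h1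
      rw [h2] at h1
      linear_combination -h1
  have hq₀0 : q₀ 0 ≠ 0 := by
    have : e.symm ((0 : Cd d), (0 : ℂ)) = 0 := map_zero e.symm
    intro h0
    rw [this, h0] at hcoef
    simp at hcoef
  set w : (AnFun d)[X] := X ^ n - ∑ i ∈ Finset.range n, C (⟨r₀ i, hr₀ i⟩ : AnFun d) * X ^ i with hw
  set H : Fin s → (AnFun d)[X] := fun j =>
    ∑ i ∈ Finset.range n, C (⟨r j i, hr j i⟩ : AnFun d) * X ^ i with hH
  have hwdeg : w.natDegree ≤ n := by
    refine (natDegree_sub_le _ _).trans (max_le (natDegree_X_pow_le n) ?_)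
    exact natDegree_le_of_degree_le (degree_sum_range_C_mul_X_pow_lt _).le
  have hHdeg : ∀ j, (H j).natDegree ≤ n := fun j =>
    natDegree_le_of_degree_le (degree_sum_range_C_mul_X_pow_lt _).le
  set Hc : ℕ → (AnFun d)[X] := fun c => ∑ j : Fin s, C ((c : AnFun d) ^ (j : ℕ)) * H j with hHc
  have hHcdeg : ∀ c, (Hc c).natDegree ≤ n := fun c =>
    natDegree_sum_le_of_forall_le _ _ fun j _ => (natDegree_C_mul_le _ _).trans (hHdeg j)
  have hweval : ∀ x z, (w.map (AnFun.eval x).toRingHom).eval z =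
      z ^ n - ∑ i ∈ Finset.range n, r₀ i x * z ^ i := by
    intro x z
    rw [hw, Polynomial.map_sub, eval_sub, eval_sum_range_C_mul_X_pow]
    simp
  have hHeval : ∀ j x z, ((H j).map (AnFun.eval x).toRingHom).eval z =
      ∑ i ∈ Finset.range n, r j i x * z ^ i := fun j x z => eval_sum_range_C_mul_X_pow _ _ _
  have hwK : toGerm (d + 1) (polyToAnFun e w) ∈ K := by
    have : toGerm (d + 1) (polyToAnFun e w) = toGerm (d + 1) (⟨q₀, hq₀⟩ * f) := by
      rw [toGerm_eq_iff]
      filter_upwards [hqr₀] with x hx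
      rw [polyToAnFun_apply, hweval, hx]
      simp
    rw [this, map_mul]
    exact K.mul_mem_left _ (hhK i₀)
  have hHK : ∀ j, toGerm (d + 1) (polyToAnFun e (H j)) ∈ K := by
    intro j
    have : toGerm (d + 1) (polyToAnFun e (H j)) = toGerm (d + 1) (h j - ⟨q j, hq j⟩ * f) := by
      rw [toGerm_eq_iff]
      filter_upwards [hqr j] with x hx
      rw [polyToAnFun_apply, hHeval]
      simp [hx]
    rw [this, map_sub, map_mul]
    exact K.sub_mem (hhK j) (K.mul_mem_left _ (hhK i₀))
  have hHcK : ∀ c, toGerm (d + 1) (polyToAnFun e (Hc c)) ∈ K := by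
    intro c
    simp only [hHc, map_sum, map_mul]
    exact K.sum_mem fun j _ => K.mul_mem_left _ (hHK j)
  -- These functions of the remaining `d` variables have pullbacks in `K`.
  set ρ : Fin (n * s + 1) → AnFun d := fun c => resultant w (Hc c) n (n + 1) with hρ
  have hρK : ∀ c, toGerm (d + 1) (polyToAnFun e (C (ρ c))) ∈ K := fun c =>
    resultant_mem_of_mem ((toGerm (d + 1)).toRingHom.comp (polyToAnFun e)) K hwdeg (hHcdeg c)
      hwK (hHcK c)
  -- If all `ρ c` vanish at a small `x`, then `w(x, ·)` and all `H j (x, ·)` share a root `z`, which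
  -- is small because the lower coefficients of `w` are. Undoing the divisions, all `h j` vanish at
  -- the point with coordinates `(x, z)`, which must be the origin.
  have hρiso : ∀ᶠ x in 𝓝 (0 : Cd d), (∀ c, (ρ c : Cd d → ℂ) x = 0) → x = 0 := by
    have hgood : ∀ᶠ x in 𝓝 (0 : Cd (d + 1)), ((∀ i, (h i : Cd (d + 1) → ℂ) x = 0) → x = 0) ∧
        q₀ x ≠ 0 ∧ ((e x).2 ^ n = q₀ x * (f : Cd (d + 1) → ℂ) x +
          ∑ i ∈ Finset.range n, r₀ i (e x).1 * (e x).2 ^ i) ∧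
        ∀ j, (h j : Cd (d + 1) → ℂ) x = q j x * (f : Cd (d + 1) → ℂ) x +
          ∑ i ∈ Finset.range n, r j i (e x).1 * (e x).2 ^ i :=
      hiso.and ((hq₀.continuousAt.eventually_ne hq₀0).and (hqr₀.and (eventually_all.2 hqr)))
    have hsymm' : Tendsto (fun y : Cd d × ℂ => e.symm y) (𝓝 0) (𝓝 0) := by
      simpa using e.symm.continuous.tendsto 0
    have hg2 := hsymm'.eventually hgood
    rw [Prod.zero_eq_mk, nhds_prod_eq, eventually_prod_iff] at hg2
    obtain ⟨pa, hpa, pb, hpb, hgood2⟩ := hg2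
    obtain ⟨δ', hδ', hball⟩ := Metric.eventually_nhds_iff.1 hpb
    set δ := min δ' 1 with hδ
    have hδpos : 0 < δ := lt_min hδ' one_pos
    have hsmall : ∀ᶠ x in 𝓝 (0 : Cd d), ∀ i ∈ Finset.range n, ‖r₀ i x‖ < δ ^ n / (n + 1) := by
      rw [Filter.eventually_all_finset]
      intro i hi
      refine (hr₀ i).continuousAt.norm.eventually_lt_const ?_
      simp only [hcoef.1 i (Finset.mem_range.1 hi), norm_zero]
      positivity
    filter_upwards [hpa, hsmall] with x hx hxs hres
    have hmonic : (w.map (AnFun.eval x).toRingHom).Monic := by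
      refine Monic.map _ ?_
      exact monic_X_pow_sub (degree_sum_range_C_mul_X_pow_lt _)
    have hdeg : (w.map (AnFun.eval x).toRingHom).natDegree = n := by
      rw [hw, Polynomial.map_sub, Polynomial.map_pow, map_X, Polynomial.map_sum]
      simp only [Polynomial.map_mul, map_C, Polynomial.map_pow, map_X]
      rw [natDegree_eq_of_degree_eq_some]
      rw [degree_sub_eq_left_of_degree_lt, degree_X_pow]
      rw [degree_X_pow]
      exact degree_sum_range_C_mul_X_pow_lt _
    obtain ⟨z, hz1, hz2⟩ := exists_common_root_of_resultant_eq_zero hmonic hdeg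
      (fun j => (H j).map (AnFun.eval x).toRingHom) (fun j => natDegree_map_le.trans (hHdeg j)) (by
        intro c
        have h1 : (AnFun.eval x).toRingHom (ρ c) = 0 := hres c
        rw [hρ] at h1
        simp only at h1
        rw [← resultant_map_map] at h1
        rw [← h1, hHc]
        congr 1
        simp only [Polynomial.map_sum, Polynomial.map_mul, map_pow, map_natCast, Polynomial.map_pow,
          Polynomial.map_natCast])
    rw [hweval] at hz1
    simp only [hHeval] at hz2
    have hzs : ‖z‖ < δ := norm_lt_of_pow_eq_sum hδpos (min_le_right _ _)
      (fun i hi => hxs i (Finset.mem_range.2 hi)) (sub_eq_zero.1 hz1)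
    have hzb : pb z := hball (by simpa using hzs.trans_le (min_le_left _ _))
    obtain ⟨k1, k2, k3, k4⟩ := hgood2 hx hzb
    simp only [ContinuousLinearEquiv.apply_symm_apply] at k3 k4
    rw [sub_eq_zero.1 hz1] at k3
    have hf0 : (f : Cd (d + 1) → ℂ) (e.symm (x, z)) = 0 := by
      have : q₀ (e.symm (x, z)) * (f : Cd (d + 1) → ℂ) (e.symm (x, z)) = 0 := by
        linear_combination -k3
      exact (mul_eq_zero.1 this).resolve_left k2
    have hx0 := k1 fun j => by rw [k4, hf0, hz2, mul_zero, add_zero]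
    have : (x, z) = 0 := by simpa using hx0
    exact (Prod.ext_iff.1 this).1
  have := ih ρ hρiso
  -- Division by `f` shows that the powers of the last coordinate below `n` generate the quotient
  -- over germs in `d` variables; the induction hypothesis makes the relevant quotient of the latter
  -- finite.
  refine finite_quotient_of_generators
    (germPullback (coordProj e) (analyticAt_coordProj e) (coordProj_zero e))
    (Ideal.span (Set.range fun c => toGerm d (ρ c))) K ?_ (n := n)
    (fun i => toGerm (d + 1) (coordLast e) ^ (i : ℕ)) ?_
  · have hle : Ideal.span (Set.range fun c => toGerm d (ρ c)) ≤ K.comap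
        (germPullback (coordProj e) (analyticAt_coordProj e) (coordProj_zero e)) := by
      rw [Ideal.span_le]
      rintro _ ⟨c, rfl⟩
      have := hρK c
      rwa [polyToAnFun_C, ← germPullback_toGerm] at this
    exact fun a ha => hle ha
  · intro y
    obtain ⟨g, rfl⟩ := toGerm_surjective _ y
    obtain ⟨qg, rg, hqg, hrg, hg⟩ := hdiv g g.2
    refine ⟨fun i => toGerm d ⟨rg i, hrg i⟩, ?_⟩
    simp only [germPullback_toGerm, ← map_pow, ← map_mul, ← map_sum, ← map_sub]
    have : toGerm (d + 1) (g - ∑ i : Fin n, AnFun.pullback (coordProj e) (analyticAt_coordProj e)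
        (coordProj_zero e) ⟨rg i, hrg i⟩ * coordLast e ^ (i : ℕ)) =
        toGerm (d + 1) (⟨qg, hqg⟩ * f) := by
      rw [toGerm_eq_iff]
      filter_upwards [hg] with x hx
      have : ((∑ i : Fin n, AnFun.pullback (coordProj e) (analyticAt_coordProj e)
        (coordProj_zero e) ⟨rg i, hrg i⟩ * coordLast e ^ (i : ℕ) : AnFun (d + 1)) :
          Cd (d + 1) → ℂ) x = ∑ i ∈ Finset.range n, rg i (e x).1 * (e x).2 ^ i := by
        rw [Finset.sum_range, ← AnFun.eval_apply, map_sum]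
        rfl
      simp only [AddSubgroupClass.coe_sub, Pi.sub_apply, this, hx]
      simp
    rw [this, map_mul]
    exact K.mul_mem_left _ (hhK i₀)

end Nullstellensatz

/-! ### Hadamard's lemma. -/

section Hadamard

variable {E : Type*} [NormedAddCommGroup E] [NormedSpace ℂ E]

/-- Divide `(y, s) ↦ F(y + s • e)` by `s`; the remainder does not depend on `s`, and comparing the
points `(y - l y • e, l y)` and `(y - l y • e, 0)` eliminates it. No normalization of `l e` is
needed. -/
theorem exists_eq_add_mul_of_clm {F : E → ℂ} (hF : AnalyticAt ℂ F 0) (l : E →L[ℂ] ℂ)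
    (e : E) : ∃ q : E → ℂ, AnalyticAt ℂ q 0 ∧
      ∀ᶠ y in 𝓝 (0 : E), F y = F (y - l y • e) + l y * q y := by
  have h1 : AnalyticAt ℂ (fun y : E × ℂ => F (y.1 + y.2 • e)) 0 := by
    refine AnalyticAt.fun_comp (g := F) (f := fun y : E × ℂ => y.1 + y.2 • e) (by simpa using hF) ?_
    exact analyticAt_fst.add (analyticAt_snd.smul analyticAt_const)
  obtain ⟨q, r, hq, hr, h⟩ := weierstrass_division (n := 1) (f := fun y : E × ℂ => y.2)
    (u := fun _ => 1) analyticAt_snd analyticAt_const one_ne_zero (by simp) h1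
  have hP : AnalyticAt ℂ (fun y : E => (y - l y • e, l y)) 0 := by
    have hl := l.analyticAt (0 : E)
    exact (analyticAt_id.sub (hl.smul analyticAt_const)).prod hl
  have t1 : Tendsto (fun y : E => (y - l y • e, l y)) (𝓝 0) (𝓝 0) := by
    have := hP.continuousAt.tendsto
    simpa only [map_zero, zero_smul, sub_zero] using! this
  have t2 : Tendsto (fun y : E => (y - l y • e, (0 : ℂ))) (𝓝 0) (𝓝 0) := by
    have : Continuous (fun y : E => (y - l y • e, (0 : ℂ))) := by fun_prop
    exact this.tendsto' _ _ (by simp)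
  refine ⟨fun y => q (y - l y • e, l y), AnalyticAt.fun_comp (g := q) (by simpa using! hq) hP, ?_⟩
  filter_upwards [t1.eventually h, t2.eventually h] with y h1 h2
  simp only [Finset.range_one, Finset.sum_singleton, pow_zero, mul_one, sub_add_cancel, zero_smul,
    add_zero, mul_zero, zero_add] at h1 h2
  rw [h1, h2]
  ring

/-- Hadamard's lemma for a biorthogonal system of coordinates. -/
theorem exists_eq_add_sum_mul {ι : Type*} {F : E → ℂ} (hF : AnalyticAt ℂ F 0)
    (l : ι → E →L[ℂ] ℂ) (e : ι → E) (hne : ∀ i j, i ≠ j → l i (e j) = 0)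
    (s : Finset ι) : ∃ q : ι → E → ℂ, (∀ i, AnalyticAt ℂ (q i) 0) ∧
      ∀ᶠ y in 𝓝 (0 : E), F y = F (y - ∑ i ∈ s, l i y • e i) + ∑ i ∈ s, l i y * q i y := by
  classical
  induction s using Finset.induction_on with
  | empty => exact ⟨fun _ _ => 0, fun _ => analyticAt_const, by simp⟩
  | insert j s hj ih =>
    obtain ⟨q, hq, h⟩ := ih
    have hP : AnalyticAt ℂ (fun y : E => y - ∑ i ∈ s, l i y • e i) 0 := by
      have : AnalyticAt ℂ (fun y => ∑ i ∈ s, l i y • e i) 0 :=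
        Finset.analyticAt_fun_sum s fun i _ => ((l i).analyticAt 0).smul analyticAt_const
      exact analyticAt_id.sub this
    have hF' : AnalyticAt ℂ (fun y => F (y - ∑ i ∈ s, l i y • e i)) 0 :=
      AnalyticAt.fun_comp (g := F) (by simpa using hF) hP
    obtain ⟨r, hr, h'⟩ := exists_eq_add_mul_of_clm hF' (l j) (e j)
    refine ⟨Function.update q j r, fun i => ?_, ?_⟩
    · by_cases hij : i = j
      · subst hij; simpa using hr
      · simpa [hij] using hq i
    · filter_upwards [h, h'] with y h1 h2
      rw [h1, h2, Finset.sum_insert hj, Finset.sum_insert hj]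
      have e1 : y - l j y • e j - ∑ i ∈ s, l i (y - l j y • e j) • e i =
          y - (l j y • e j + ∑ i ∈ s, l i y • e i) := by
        rw [sub_sub]
        congr 2
        refine Finset.sum_congr rfl fun i hi => ?_
        have : i ≠ j := by rintro rfl; exact hj hi
        simp [hne i j this]
      have e2 : ∑ i ∈ s, l i y * Function.update q j r i y = ∑ i ∈ s, l i y * q i y := by
        refine Finset.sum_congr rfl fun i hi => ?_
        have : i ≠ j := by rintro rfl; exact hj hi
        simp [this]
      rw [e1, e2]
      simp
      ring

end Hadamard

/-! ### The maximal ideal, its powers, and Nakayama's lemma. -/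

section MaximalIdeal

variable {d d' : ℕ}

/-- The value of a germ at the origin. -/
noncomputable def germEval (d : ℕ) : HolGerm d →ₐ[ℂ] ℂ where
  toRingHom := (Germ.valueRingHom (x := (0 : Cd d)) (E := ℂ)).comp (HolGerm d).subtype
  commutes' _ := rfl

theorem germEval_toGerm (f : AnFun d) : germEval d (toGerm d f) = (f : Cd d → ℂ) 0 := rfl

/-- The maximal ideal of the ring of germs. -/
noncomputable def germMax (d : ℕ) : Ideal (HolGerm d) := RingHom.ker (germEval d)

theorem mem_germMax {φ : HolGerm d} : φ ∈ germMax d ↔ germEval d φ = 0 := Iff.rfl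

/-- The coordinate functions. -/
noncomputable def coordFun (d : ℕ) (i : Fin d) : AnFun d :=
  ⟨fun x => x i, (ContinuousLinearMap.proj (R := ℂ) (φ := fun _ : Fin d => ℂ) i).analyticAt 0⟩

/-- Hadamard's lemma writes a function vanishing at the origin as `∑ x_i q_i`. -/
theorem germMax_eq_span (d : ℕ) :
    germMax d = Ideal.span (Set.range fun i => toGerm d (coordFun d i)) := by
  apply le_antisymm
  · intro φ hφ
    obtain ⟨f, rfl⟩ := toGerm_surjective d φ
    rw [mem_germMax, germEval_toGerm] at hφ
    obtain ⟨q, hq, h⟩ := exists_eq_add_sum_mul f.2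
      (fun i : Fin d => ContinuousLinearMap.proj (R := ℂ) (φ := fun _ : Fin d => ℂ) i)
      (fun i => Pi.single i 1) (fun i j hij => by simp [hij]) Finset.univ
    have : toGerm d f = toGerm d (∑ i, coordFun d i * ⟨q i, hq i⟩) := by
      rw [toGerm_eq_iff]
      filter_upwards [h] with y hy
      have e1 : ∑ i : Fin d, y i • (Pi.single i (1 : ℂ) : Fin d → ℂ) = y := by
        ext j; simp [Finset.sum_apply, Pi.single_apply]
      have e2 : ((∑ i, coordFun d i * ⟨q i, hq i⟩ : AnFun d) : Cd d → ℂ) y =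
          ∑ i, y i * q i y := by
        rw [← AnFun.eval_apply, map_sum]; rfl
      rw [e2, hy]
      simp [e1, hφ]
    rw [this, map_sum]
    refine Ideal.sum_mem _ fun i _ => ?_
    rw [map_mul]
    exact Ideal.mul_mem_right _ _ (Ideal.subset_span ⟨i, rfl⟩)
  · rw [Ideal.span_le]
    rintro _ ⟨i, rfl⟩
    rfl

theorem germMax_fg (d : ℕ) : (germMax d).FG := by
  rw [germMax_eq_span]
  exact Submodule.fg_span (Set.finite_range _)

theorem isUnit_of_germEval_ne_zero {φ : HolGerm d} (h : germEval d φ ≠ 0) : IsUnit φ := by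
  obtain ⟨f, rfl⟩ := toGerm_surjective d φ
  rw [germEval_toGerm] at h
  refine IsUnit.of_mul_eq_one (toGerm d ⟨fun x => ((f : Cd d → ℂ) x)⁻¹, f.2.inv h⟩) ?_
  rw [← map_mul, ← map_one (toGerm d), toGerm_eq_iff]
  filter_upwards [f.2.continuousAt.eventually_ne h] with x hx
  exact mul_inv_cancel₀ hx

theorem germMax_le_jacobson (d : ℕ) : germMax d ≤ Ideal.jacobson ⊥ := by
  intro φ hφ
  rw [Ideal.mem_jacobson_bot]
  intro ψ
  apply isUnit_of_germEval_ne_zero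
  rw [map_add, map_mul, mem_germMax.1 hφ]
  simp

/-- Pass from `k` to `k + 1` by adding finitely many generators of `𝔪^k`: modulo `𝔪^(k+1)` their
coefficients may be replaced by the values of these at the origin. -/
theorem exists_fg_complement_germMax_pow (d k : ℕ) : ∃ W : Submodule ℂ (HolGerm d), W.FG ∧
    ∀ φ, ∃ c ∈ W, φ - c ∈ germMax d ^ k := by
  induction k with
  | zero => exact ⟨⊥, Submodule.fg_bot, fun φ => ⟨0, Submodule.zero_mem _, by simp⟩⟩
  | succ k ih =>
    obtain ⟨W, hW, h⟩ := ih
    obtain ⟨t, ht⟩ := (germMax_fg d).pow (n := k)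
    refine ⟨W ⊔ Submodule.span ℂ t, hW.sup (Submodule.fg_span t.finite_toSet), fun φ => ?_⟩
    have key : ∀ ψ ∈ Submodule.span (HolGerm d) (t : Set (HolGerm d)),
        ∃ c ∈ Submodule.span ℂ (t : Set (HolGerm d)), ψ - c ∈ germMax d ^ (k + 1) := by
      intro ψ hψ
      induction hψ using Submodule.span_induction with
      | mem x hx => exact ⟨x, Submodule.subset_span hx, by simp⟩
      | zero => exact ⟨0, Submodule.zero_mem _, by simp⟩
      | add x y _ _ hx hy =>
        obtain ⟨c, hc, hxc⟩ := hx
        obtain ⟨c', hc', hyc⟩ := hy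
        refine ⟨c + c', Submodule.add_mem _ hc hc', ?_⟩
        convert Ideal.add_mem _ hxc hyc using 1
        ring
      | smul a x hx' hx =>
        obtain ⟨c, hc, hxc⟩ := hx
        refine ⟨germEval d a • c, Submodule.smul_mem _ _ hc, ?_⟩
        have hx'' : x ∈ germMax d ^ k := by rw [← ht]; exact hx'
        have ha : a - algebraMap ℂ (HolGerm d) (germEval d a) ∈ germMax d := by
          rw [mem_germMax, map_sub, AlgHom.commutes]
          simp
        have h1 := Ideal.mul_mem_mul ha hx''
        rw [← pow_succ'] at h1
        have h2 := Ideal.mul_mem_left _ (algebraMap ℂ (HolGerm d) (germEval d a)) hxc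
        convert Ideal.add_mem _ h1 h2 using 1
        rw [smul_eq_mul, Algebra.smul_def]
        ring
    obtain ⟨c, hc, hφ⟩ := h φ
    rw [← ht] at hφ
    obtain ⟨c', hc', hφ'⟩ := key _ hφ
    refine ⟨c + c', Submodule.add_mem_sup hc hc', ?_⟩
    rwa [← sub_sub]

instance finite_quotient_germMax_pow (d k : ℕ) : Module.Finite ℂ (HolGerm d ⧸ germMax d ^ k) := by
  obtain ⟨W, hW, h⟩ := exists_fg_complement_germMax_pow d k
  have : Module.Finite ℂ W := Module.Finite.iff_fg.2 hW
  refine Module.Finite.of_surjective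
    ((Ideal.Quotient.mkₐ ℂ (germMax d ^ k)).toLinearMap.comp W.subtype) fun y => ?_
  obtain ⟨φ, rfl⟩ := Ideal.Quotient.mk_surjective y
  obtain ⟨c, hc, hφ⟩ := h φ
  exact ⟨⟨c, hc⟩, (Ideal.Quotient.eq.2 hφ).symm⟩

/-- Nakayama's lemma. Only `N`, later a power of `𝔪`, has to be finitely generated, so Noetherianity
of the ring of germs is not needed. -/
theorem le_of_le_sup_mul_germMax {N K : Ideal (HolGerm d)} (hN : N.FG)
    (h : N ≤ K ⊔ germMax d * N) : N ≤ K :=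
  Submodule.le_of_le_smul_of_le_jacobson_bot hN (germMax_le_jacobson d) h

end MaximalIdeal

/-! ### Closed conditions over a Noetherian algebra of functions. -/

section Noetherian

/-- The condition that the rank of a family of vectors is at least `s` is open in the topology
defined by an algebra containing the coordinates of the vectors. -/
theorem exists_mem_ne_zero_of_le_finrank_span {k P V ι : Type*} [Field k] [AddCommGroup V]
    [Module k V] [FiniteDimensional k V] (R : Subalgebra k (P → k)) (w : ι → P → V)
    (hw : ∀ i (l : V →ₗ[k] k), (fun p => l (w i p)) ∈ R) (p₀ : P) {s : ℕ}
    (hs : s ≤ Module.finrank k (Submodule.span k (Set.range fun i => w i p₀))) :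
    ∃ h ∈ R, h p₀ ≠ 0 ∧
      ∀ p, h p ≠ 0 → s ≤ Module.finrank k (Submodule.span k (Set.range fun i => w i p)) := by
  obtain ⟨r, hs, f, hf, hli⟩ : ∃ r, s ≤ r ∧ ∃ f : Fin r → V,
      (∀ j, f j ∈ Set.range fun i => w i p₀) ∧ LinearIndependent k f := by
    obtain ⟨f, hf, -, hli⟩ := Submodule.exists_fun_fin_finrank_span_eq k
      (Set.range fun i => w i p₀)
    exact ⟨_, hs, f, hf, hli⟩
  choose a ha using hf
  obtain ⟨g, hg⟩ := LinearMap.exists_leftInverse_of_injective (Fintype.linearCombination k f)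
    (LinearMap.ker_eq_bot.2 hli.fintypeLinearCombination_injective)
  have hgf : ∀ j, g (f j) = Pi.single j 1 := by
    intro j
    have := LinearMap.congr_fun hg (Pi.single j 1)
    simpa [Fintype.linearCombination_apply_single] using! this
  -- A minor of the family, taken in the coordinates `g` dual to an independent subfamily at `p₀`;
  -- there it equals `1`, and wherever it is nonzero the same vectors stay independent.
  let M : Matrix (Fin r) (Fin r) R := Matrix.of fun i j =>
    ⟨fun p => (LinearMap.proj i ∘ₗ g) (w (a j) p), hw (a j) _⟩
  have hdet : ∀ p, (M.det : P → k) p = (Matrix.of fun i j => g (w (a j) p) i).det := by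
    intro p
    have := RingHom.map_det ((Pi.evalRingHom (fun _ : P => k) p).comp R.val.toRingHom) M
    exact this
  refine ⟨M.det, M.det.2, ?_, fun p hp => hs.trans ?_⟩
  · rw [hdet]
    have : (Matrix.of fun i j => g (w (a j) p₀) i) = (1 : Matrix (Fin r) (Fin r) k) := by
      ext i j
      have e : w (a j) p₀ = f j := ha j
      rw [Matrix.of_apply, e, hgf, Matrix.one_apply, Pi.single_apply]
    rw [this, Matrix.det_one]
    exact one_ne_zero
  · rw [hdet] at hp
    have h1 := Matrix.linearIndependent_cols_of_det_ne_zero hp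
    have h2 : LinearIndependent k fun j => w (a j) p := by
      refine LinearIndependent.of_comp g ?_
      exact h1
    have h3 := finrank_span_eq_card h2
    rw [Fintype.card_fin] at h3
    rw [← h3]
    refine Submodule.finrank_mono (Submodule.span_mono ?_)
    rintro _ ⟨j, rfl⟩
    exact ⟨a j, rfl⟩

/-- Descending chains of sets which are closed in the topology defined by a Noetherian algebra of
functions stabilize. -/
theorem exists_stable_of_isNoetherianRing {k P : Type*} [Field k] (R : Subalgebra k (P → k))
    [IsNoetherianRing R] {Z : ℕ → Set P} (hZ : Antitone Z)
    (hclosed : ∀ r, ∀ p ∉ Z r, ∃ h ∈ R, h p ≠ 0 ∧ ∀ p' ∈ Z r, h p' = 0) :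
    ∃ m, ∀ r, m ≤ r → Z m ⊆ Z r := by
  let I : ℕ →o Ideal R :=
    { toFun := fun r =>
        { carrier := {h | ∀ p ∈ Z r, (h : P → k) p = 0}
          add_mem' := fun {a b} ha hb p hp => by
            change (a : P → k) p + (b : P → k) p = 0
            rw [ha p hp, hb p hp, add_zero]
          zero_mem' := fun _ _ => rfl
          smul_mem' := fun c x hx p hp => by
            change (c : P → k) p * (x : P → k) p = 0
            rw [hx p hp, mul_zero] }
      monotone' := fun _ _ hrs _ hh p hp => hh p (hZ hrs hp) }
  obtain ⟨m, hm⟩ := monotone_stabilizes_iff_noetherian.2 ‹IsNoetherianRing R› I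
  refine ⟨m, fun r hr p hp => ?_⟩
  by_contra hpr
  obtain ⟨h, hR, hp0, hz⟩ := hclosed r p hpr
  have : (⟨h, hR⟩ : R) ∈ I m := by
    rw [hm r hr]
    exact hz
  exact hp0 (this p hp)

end Noetherian

/-! ### Codimension of ideals and its boundedness in families. -/

section Codimension

variable {d : ℕ}

/-- An ideal whose codimension modulo `𝔪 ^ r` is less than `r` contains `𝔪 ^ r`. -/
theorem germMax_pow_le_of_finrank_lt {K : Ideal (HolGerm d)} {r : ℕ}
    (h : Module.finrank ℂ (HolGerm d ⧸ K ⊔ germMax d ^ r) < r) : germMax d ^ r ≤ K := by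
  have hfin : ∀ i, Module.Finite ℂ (HolGerm d ⧸ K ⊔ germMax d ^ i) := fun i =>
    have hi : germMax d ^ i ≤ K ⊔ germMax d ^ i := le_sup_right
    Module.Finite.of_surjective (Ideal.Quotient.factorₐ ℂ hi).toLinearMap
      (Ideal.Quotient.factor_surjective hi)
  by_contra hK
  -- An equality in the chain `K + 𝔪^i` would give `𝔪^i ≤ K` by Nakayama. So each of the first `r`
  -- steps raises the codimension by at least one.
  have hstrict : ∀ i, i < r → ¬ germMax d ^ i ≤ K ⊔ germMax d ^ (i + 1) := by
    intro i hi hle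
    apply hK
    refine (Ideal.pow_le_pow_right hi.le).trans
      (le_of_le_sup_mul_germMax ((germMax_fg d).pow) ?_)
    rwa [← pow_succ']
  have key : ∀ i, i ≤ r → i ≤ Module.finrank ℂ (HolGerm d ⧸ K ⊔ germMax d ^ i) := by
    intro i
    induction i with
    | zero => intro _; exact Nat.zero_le _
    | succ i ih =>
      intro hi
      refine Nat.succ_le_of_lt ((ih (by omega)).trans_lt ?_)
      have hle : K ⊔ germMax d ^ (i + 1) ≤ K ⊔ germMax d ^ i :=
        sup_le_sup_left (Ideal.pow_le_pow_right (Nat.le_succ i)) _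
      let F := (Ideal.Quotient.factorₐ ℂ hle).toLinearMap
      have hF : Function.Surjective F := Ideal.Quotient.factor_surjective hle
      by_contra! hlt
      have hinj : Function.Injective F :=
        (LinearMap.injective_iff_surjective_of_finrank_eq_finrank
          (le_antisymm hlt (LinearMap.finrank_le_finrank_of_surjective hF))).2 hF
      apply hstrict i (by omega)
      intro x hx
      rw [← Ideal.Quotient.eq_zero_iff_mem]
      apply hinj
      rw [map_zero]
      exact Ideal.Quotient.eq_zero_iff_mem.2 (Ideal.mem_sup_right hx)
  exact absurd (key r le_rfl) (not_le.2 h)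

instance free_quotient (K : Ideal (HolGerm d)) : Module.Free ℂ (HolGerm d ⧸ K) :=
  Module.Free.of_divisionRing ℂ _

/-- The codimension of an ideal of germs. -/
noncomputable def codim (K : Ideal (HolGerm d)) : ℕ∞ := (Module.rank ℂ (HolGerm d ⧸ K)).toENat

/-- The right side concerns a quotient of the finite-dimensional space of jets. It implies `𝔪^r ≤
K`, and then the two quotients coincide. -/
theorem codim_lt_coe_iff {K : Ideal (HolGerm d)} {r : ℕ} :
    codim K < r ↔ Module.finrank ℂ (HolGerm d ⧸ K ⊔ germMax d ^ r) < r := by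
  constructor
  · intro h
    have hfin : Module.Finite ℂ (HolGerm d ⧸ K) := by
      rw [← Module.rank_lt_aleph0_iff, ← Cardinal.toENat_lt_top]
      exact h.trans (ENat.natCast_lt_top r)
    rw [codim, ← Module.finrank_eq_rank, map_natCast, Nat.cast_lt] at h
    have hle : K ≤ K ⊔ germMax d ^ r := le_sup_left
    exact (LinearMap.finrank_le_finrank_of_surjective (f := (Ideal.Quotient.factorₐ ℂ
      hle).toLinearMap) (Ideal.Quotient.factor_surjective hle)).trans_lt h
  · intro h
    have hle := germMax_pow_le_of_finrank_lt h
    rw [sup_eq_left.2 hle] at h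
    have hfin : Module.Finite ℂ (HolGerm d ⧸ K) :=
      Module.Finite.of_surjective (Ideal.Quotient.factorₐ ℂ hle).toLinearMap
        (Ideal.Quotient.factor_surjective hle)
    rw [codim, ← Module.finrank_eq_rank, map_natCast, Nat.cast_lt]
    exact h

/-- The codimension of `K` modulo `𝔪 ^ k` in terms of the span of generators. -/
theorem finrank_quotient_sup_add (K : Ideal (HolGerm d)) (k : ℕ) {S : Set (HolGerm d)}
    (hS : (Submodule.span ℂ S : Set (HolGerm d)) = K) :
    Module.finrank ℂ (HolGerm d ⧸ K ⊔ germMax d ^ k) +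
      Module.finrank ℂ (Submodule.span ℂ (Ideal.Quotient.mkₐ ℂ (germMax d ^ k) '' S)) =
      Module.finrank ℂ (HolGerm d ⧸ germMax d ^ k) := by
  have h1 : Submodule.span ℂ (Ideal.Quotient.mkₐ ℂ (germMax d ^ k) '' S) =
      (K.map (Ideal.Quotient.mkₐ ℂ (germMax d ^ k))).restrictScalars ℂ := by
    have h0 := Submodule.map_span (Ideal.Quotient.mkₐ ℂ (germMax d ^ k)).toLinearMap S
    have h0' : Submodule.span ℂ (Ideal.Quotient.mkₐ ℂ (germMax d ^ k) '' S) =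
      Submodule.map (Ideal.Quotient.mkₐ ℂ (germMax d ^ k)).toLinearMap (Submodule.span ℂ S) :=
      h0.symm
    rw [h0']
    ext x
    rw [Submodule.mem_map, Submodule.restrictScalars_mem,
      Ideal.mem_map_iff_of_surjective _ (Ideal.Quotient.mkₐ_surjective ℂ _)]
    constructor
    · rintro ⟨y, hy, rfl⟩
      exact ⟨y, by rw [← SetLike.mem_coe, ← hS]; exact hy, rfl⟩
    · rintro ⟨y, hy, rfl⟩
      exact ⟨y, by rw [← SetLike.mem_coe, ← hS] at hy; exact hy, rfl⟩
  rw [h1, sup_comm, ← (DoubleQuot.quotQuotEquivQuotSupₐ ℂ (germMax d ^ k)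
    K).toLinearEquiv.finrank_eq]
  exact Submodule.finrank_quotient_add_finrank
    ((K.map (Ideal.Quotient.mkₐ ℂ (germMax d ^ k))).restrictScalars ℂ)

/-- Boundedness of the finite codimensions in a family of ideals with generators whose jets depend
on the parameter through a Noetherian algebra of functions. -/
theorem exists_codim_bound {P ι : Type*} (R : Subalgebra ℂ (P → ℂ)) [IsNoetherianRing R]
    (K : P → Ideal (HolGerm d)) (w : ι → P → HolGerm d)
    (hK : ∀ p, (Submodule.span ℂ (Set.range fun i => w i p) : Set (HolGerm d)) = K p)
    (hw : ∀ k i (l : (HolGerm d ⧸ germMax d ^ k) →ₗ[ℂ] ℂ),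
      (fun p => l (Ideal.Quotient.mk _ (w i p))) ∈ R) :
    ∃ m : ℕ, ∀ p, codim (K p) ≠ ⊤ → codim (K p) ≤ m := by
  obtain ⟨m, hm⟩ := exists_stable_of_isNoetherianRing R
    (Z := fun r => {p | (r : ℕ∞) ≤ codim (K p)})
    (fun r s hrs p hp => le_trans (Nat.cast_le.2 hrs : (r : ℕ∞) ≤ s) hp) (by
      intro r p hp
      rw [Set.mem_ofPred_eq, not_le, codim_lt_coe_iff] at hp
      set V := HolGerm d ⧸ germMax d ^ r
      have himg : ∀ p, Ideal.Quotient.mkₐ ℂ (germMax d ^ r) '' (Set.range fun i => w i p) =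
          Set.range fun i => (Ideal.Quotient.mk (germMax d ^ r) (w i p)) := fun p =>
        (Set.range_comp _ _).symm
      have hdim : ∀ p, Module.finrank ℂ (HolGerm d ⧸ K p ⊔ germMax d ^ r) +
          Module.finrank ℂ (Submodule.span ℂ
            (Set.range fun i => (Ideal.Quotient.mk (germMax d ^ r) (w i p)))) =
          Module.finrank ℂ V := fun p => by
        rw [← himg]
        exact finrank_quotient_sup_add (K p) r (hK p)
      obtain ⟨h, hR, h0, hh⟩ := exists_mem_ne_zero_of_le_finrank_span R
        (fun i p => (Ideal.Quotient.mk (germMax d ^ r) (w i p))) (hw r) p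
        -- Codimension less than `r` in `V` means rank at least `dim V + 1 - r`. When the
        -- subtraction truncates, `r` exceeds `dim V` and both conditions hold trivially.
        (s := Module.finrank ℂ V + 1 - r) (by have := hdim p; omega)
      refine ⟨h, hR, h0, fun p' hp' => ?_⟩
      by_contra hne
      have h1 := hh p' hne
      rw [Set.mem_ofPred_eq, ← not_lt, codim_lt_coe_iff] at hp'
      have h2 := hdim p'
      omega)
  refine ⟨m, fun p hp => ?_⟩
  by_contra! hlt
  obtain ⟨n, hn⟩ := ENat.ne_top_iff_exists.1 hp
  rw [← hn, Nat.cast_lt] at hlt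
  -- Past the stable index the codimension would be at least every `r`, in particular at least `n +
  -- 1`, although it equals `n`.
  have := hm (n + 1) (by omega) (show (m : ℕ∞) ≤ codim (K p) by rw [← hn]; exact_mod_cast hlt.le)
  rw [Set.mem_ofPred_eq, ← hn] at this
  have : n + 1 ≤ n := by exact_mod_cast this
  omega

end Codimension

/-! ### Generalized eigenspaces of automorphisms and derivations. -/

section GeneralizedEigenspaces

variable {V : Type*} [CommRing V] [Algebra ℂ V]

/-- Each application of `f - c` to a product lowers the nilpotency exponent of one factor, and `s`
does no harm because it commutes with `f`; so `k + l` applications annihilate `x * y`. Automorphisms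
(`s = f`, `κ = a`, `c = ab`) and derivations (`s = id`, `κ = 1`, `c = a + b`) are both covered. -/
theorem mul_mem_maxGenEigenspace_of_recursion {f : Module.End ℂ V} {a b c : ℂ} (s : V →ₗ[ℂ] V)
    (κ : ℂ) (hs : Commute f s)
    (hf : ∀ x y, (f - algebraMap ℂ (Module.End ℂ V) c) (x * y) =
      (f - algebraMap ℂ (Module.End ℂ V) a) x * s y +
        κ • (x * (f - algebraMap ℂ (Module.End ℂ V) b) y)) {x y : V}
    (hx : x ∈ f.maxGenEigenspace a) (hy : y ∈ f.maxGenEigenspace b) :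
    x * y ∈ f.maxGenEigenspace c := by
  simp only [Module.End.mem_maxGenEigenspace, ← Algebra.algebraMap_eq_smul_one] at hx hy ⊢
  obtain ⟨k, hk⟩ := hx
  obtain ⟨l, hl⟩ := hy
  refine ⟨k + l, ?_⟩
  have key : ∀ n k l : ℕ, k + l = n → ∀ x y,
      ((f - algebraMap ℂ (Module.End ℂ V) a) ^ k) x = 0 →
      ((f - algebraMap ℂ (Module.End ℂ V) b) ^ l) y = 0 →
      ((f - algebraMap ℂ (Module.End ℂ V) c) ^ n) (x * y) = 0 := by
    intro n
    induction n with
    | zero =>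
      intro k l hkl x y hx _
      obtain rfl : k = 0 := by omega
      have : x = 0 := hx
      simp [this]
    | succ n ih =>
      intro k l hkl x y hx hy
      rcases k with _ | k
      · have : x = 0 := hx
        simp [this]
      rcases l with _ | l
      · have : y = 0 := hy
        simp [this]
      rw [pow_succ, Module.End.mul_apply, hf, map_add, map_smul,
        ih k (l + 1) (by omega) _ _ (by rwa [← Module.End.mul_apply, ← pow_succ]) ?_,
        ih (k + 1) l (by omega) _ _ hx (by rwa [← Module.End.mul_apply, ← pow_succ])]
      · simp
      · have hc : Commute ((f - algebraMap ℂ (Module.End ℂ V) b) ^ (l + 1)) s :=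
          (hs.sub_left (Algebra.commutes' b s)).pow_left _
        have := LinearMap.congr_fun hc.eq y
        rw [Module.End.mul_apply, Module.End.mul_apply, hy, map_zero] at this
        exact this
  exact key _ k l rfl x y hk hl

theorem AlgHom.mul_mem_maxGenEigenspace (f : V →ₐ[ℂ] V) {a b : ℂ} {x y : V}
    (hx : x ∈ Module.End.maxGenEigenspace f.toLinearMap a)
    (hy : y ∈ Module.End.maxGenEigenspace f.toLinearMap b) :
    x * y ∈ Module.End.maxGenEigenspace f.toLinearMap (a * b) := by
  refine mul_mem_maxGenEigenspace_of_recursion f.toLinearMap a (Commute.refl _) ?_ hx hy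
  intro x y
  simp only [LinearMap.sub_apply, AlgHom.toLinearMap_apply, Module.algebraMap_end_apply,
    Algebra.smul_def]
  simp only [map_mul]
  ring

theorem mul_mem_maxGenEigenspace_of_leibniz {f : Module.End ℂ V}
    (hf : ∀ x y, f (x * y) = f x * y + x * f y) {a b : ℂ} {x y : V}
    (hx : x ∈ f.maxGenEigenspace a) (hy : y ∈ f.maxGenEigenspace b) :
    x * y ∈ f.maxGenEigenspace (a + b) := by
  refine mul_mem_maxGenEigenspace_of_recursion LinearMap.id 1 (Commute.one_right _) ?_ hx hy
  intro x y
  simp only [LinearMap.sub_apply, hf, Module.algebraMap_end_apply, Algebra.smul_def,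
    LinearMap.id_apply]
  simp only [map_add, map_one]
  ring

/-- A subalgebra which generates modulo the square of a nilpotent ideal is everything. -/
theorem eq_top_of_sup_sq_eq_top {U : Submodule ℂ V} {N : Ideal V} (hU : U * U ≤ U)
    (hN : IsNilpotent N) (h : ∀ v, ∃ u ∈ U, v - u ∈ N ^ 2) : U = ⊤ := by
  -- Successive approximation: if `u` and `v` in `U` approximate `x` and `y`, then `x * y - u * v =
  -- (x - u) * y + u * (y - v)` lies one power of `N` deeper.
  have step : ∀ i, 1 ≤ i → ∀ x ∈ N ^ i, ∃ u ∈ U, u ∈ N ^ i ∧ x - u ∈ N ^ (i + 1) := by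
    intro i hi
    induction i, hi using Nat.le_induction with
    | base =>
      intro x hx
      obtain ⟨u, hu, hxu⟩ := h x
      refine ⟨u, hu, ?_, hxu⟩
      have := Ideal.sub_mem _ hx (Ideal.pow_le_pow_right one_le_two hxu)
      simpa using this
    | succ i hi ih =>
      intro x hx
      rw [pow_succ] at hx
      induction hx using Submodule.mul_induction_on' with
      | mem_mul_mem x hx y hy =>
        obtain ⟨u, hu, hui, hxu⟩ := ih x hx
        obtain ⟨v, hv, hyv⟩ := h y
        have hvN : v ∈ N := by
          have := Ideal.sub_mem _ hy (Ideal.pow_le_self two_ne_zero hyv)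
          simpa using this
        refine ⟨u * v, hU (Submodule.mul_mem_mul hu hv), ?_, ?_⟩
        · rw [pow_succ]; exact Ideal.mul_mem_mul hui hvN
        · have e : x * y - u * v = (x - u) * y + u * (y - v) := by ring
          rw [e]
          refine Ideal.add_mem _ ?_ ?_
          · rw [pow_succ]; exact Ideal.mul_mem_mul hxu hy
          · have := Ideal.mul_mem_mul hui hyv
            rwa [← pow_add] at this
      | add x _ y _ hx hy =>
        obtain ⟨u, hu, hui, hxu⟩ := hx
        obtain ⟨v, hv, hvi, hyv⟩ := hy
        refine ⟨u + v, U.add_mem hu hv, Ideal.add_mem _ hui hvi, ?_⟩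
        convert Ideal.add_mem _ hxu hyv using 1
        ring
  have key : ∀ i, ∀ v, ∃ u ∈ U, v - u ∈ N ^ (i + 2) := by
    intro i
    induction i with
    | zero => exact h
    | succ i ih =>
      intro v
      obtain ⟨u, hu, hvu⟩ := ih v
      obtain ⟨u', hu', -, hvu'⟩ := step (i + 2) (by omega) _ hvu
      exact ⟨u + u', U.add_mem hu hu', by rwa [← sub_sub]⟩
  obtain ⟨k, hk⟩ := hN
  rw [eq_top_iff]
  intro v _
  obtain ⟨u, hu, hvu⟩ := key k v
  rw [pow_add, hk, zero_mul] at hvu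
  have : v = u := sub_eq_zero.1 hvu
  rwa [this]

/-- The sum of the eigenspaces indexed by `M` is closed under products and exhausts `V` modulo `N ^
2`, since the remaining eigenspaces lie in `N ^ 2`. -/
theorem iSup_maxGenEigenspace_eq_top_of_mul [FiniteDimensional ℂ V] {f : Module.End ℂ V}
    {M : Set ℂ} {N : Ideal V} (hN : IsNilpotent N)
    (hmul : ∀ a ∈ M, ∀ b ∈ M, ∀ x ∈ f.maxGenEigenspace a, ∀ y ∈ f.maxGenEigenspace b,
      ∃ c ∈ M, x * y ∈ f.maxGenEigenspace c)
    (hout : ∀ a ∉ M, ∀ x ∈ f.maxGenEigenspace a, x ∈ N ^ 2) :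
    ⨆ a ∈ M, f.maxGenEigenspace a = ⊤ := by
  refine eq_top_of_sup_sq_eq_top (N := N) ?_ hN ?_
  · simp only [Submodule.iSup_mul, Submodule.mul_iSup]
    simp only [iSup_le_iff]
    intro a ha b hb
    rw [Submodule.mul_le]
    intro x hx y hy
    obtain ⟨c, hc, hxy⟩ := hmul b hb a ha x hx y hy
    exact Submodule.mem_iSup_of_mem c (Submodule.mem_iSup_of_mem hc hxy)
  · intro v
    have hv : v ∈ ⨆ a, f.maxGenEigenspace a := by
      rw [Module.End.iSup_maxGenEigenspace_eq_top]; trivial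
    induction hv using Submodule.iSup_induction' with
    | mem a x hx =>
      by_cases ha : a ∈ M
      · exact ⟨x, Submodule.mem_iSup_of_mem a (Submodule.mem_iSup_of_mem ha hx), by simp⟩
      · exact ⟨0, Submodule.zero_mem _, by simpa using hout a ha x hx⟩
    | zero => exact ⟨0, Submodule.zero_mem _, by simp⟩
    | add x y _ _ hx hy =>
      obtain ⟨u, hu, hxu⟩ := hx
      obtain ⟨v, hv, hyv⟩ := hy
      refine ⟨u + v, Submodule.add_mem _ hu hv, ?_⟩
      convert Ideal.add_mem _ hxu hyv using 1
      ring

end GeneralizedEigenspaces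

/-! ### Transport of generalized eigenvectors along intertwining maps. -/

section GeneralizedEigenspaces

variable {V W : Type*} [CommRing V] [Algebra ℂ V] [CommRing W] [Algebra ℂ W]

theorem mem_maxGenEigenspace_of_intertwine {π : V →ₗ[ℂ] W} {f : Module.End ℂ V}
    {g : Module.End ℂ W} (h : ∀ x, π (f x) = g (π x)) {a : ℂ} {x : V}
    (hx : x ∈ f.maxGenEigenspace a) : π x ∈ g.maxGenEigenspace a := by
  rw [Module.End.mem_maxGenEigenspace] at hx ⊢
  obtain ⟨k, hk⟩ := hx
  refine ⟨k, ?_⟩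
  have : ∀ k x, π (((f - a • (1 : Module.End ℂ V)) ^ k) x) =
      ((g - a • (1 : Module.End ℂ W)) ^ k) (π x) := by
    intro k
    induction k with
    | zero => intro x; rfl
    | succ k ih => intro x; rw [pow_succ, pow_succ, Module.End.mul_apply, ih]; simp [h]
  rw [← this, hk, map_zero]

theorem eq_zero_of_mem_maxGenEigenspace {g : Module.End ℂ W} {a : ℂ} (ha : ¬ g.HasEigenvalue a)
    {x : W} (hx : x ∈ g.maxGenEigenspace a) : x = 0 := by
  rw [Module.End.mem_maxGenEigenspace] at hx
  obtain ⟨k, hk⟩ := hx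
  have h0 : g.eigenspace a = ⊥ := by
    by_contra h
    exact ha (Module.End.hasEigenvalue_iff.2 h)
  induction k with
  | zero => exact hk
  | succ k ih =>
    apply ih
    rw [pow_succ', Module.End.mul_apply] at hk
    rw [← Submodule.mem_bot ℂ, ← h0, Module.End.mem_eigenspace_iff]
    simpa [sub_eq_zero] using hk

end GeneralizedEigenspaces

/-! ### Matrix coefficients of the integer powers of an automorphism. -/

section Iterates

/-- Binomial coefficients are polynomials in `n`, through `(j + 1) C(n, j + 1) = C(n, j) (n - j)`.
-/
theorem choose_mem_subalgebra {R : Subalgebra ℂ (ℤ → ℂ)} (h : (fun n : ℤ => (n : ℂ)) ∈ R) (j : ℕ) :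
    (fun n : ℤ => ((Ring.choose n j : ℤ) : ℂ)) ∈ R := by
  induction j with
  | zero =>
    simp only [Ring.choose_zero_right, Int.cast_one]
    exact R.one_mem
  | succ j ih =>
    have e : (fun n : ℤ => ((Ring.choose n (j + 1) : ℤ) : ℂ)) =
        ((j : ℂ) + 1)⁻¹ • ((fun n : ℤ => ((Ring.choose n j : ℤ) : ℂ)) *
          ((fun n : ℤ => (n : ℂ)) - algebraMap ℂ _ (j : ℂ))) := by
      funext n
      have h1 := Ring.choose_smul_choose n (n := j + 1) (k := j) (by omega)
      simp only [Nat.choose_succ_self_right, add_tsub_cancel_left, Ring.choose_one_right,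
        nsmul_eq_mul] at h1
      have h3 : ((j : ℂ) + 1) * ((Ring.choose n (j + 1) : ℤ) : ℂ) =
          ((Ring.choose n j : ℤ) : ℂ) * ((n : ℂ) - j) := by exact_mod_cast h1
      have h4 : ((j : ℂ) + 1) ≠ 0 := by exact_mod_cast Nat.succ_ne_zero j
      simp only [Pi.smul_apply, Pi.mul_apply, Pi.sub_apply, smul_eq_mul, Pi.algebraMap_apply,
        Algebra.algebraMap_self, RingHom.id_apply]
      rw [← h3, inv_mul_cancel_left₀ h4]
    rw [e]
    exact R.smul_mem (R.mul_mem ih (R.sub_mem h (R.algebraMap_mem _))) _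

variable {V : Type*} [AddCommGroup V] [Module ℂ V]

/-- Matrix coefficients of the powers of an automorphism at a generalized eigenvector. -/
theorem exists_zpow_apply_eq (f : (Module.End ℂ V)ˣ) {a : ℂ} (ha : a ≠ 0) (l : V →ₗ[ℂ] ℂ) (K : ℕ)
    (x : V) (hx : (((f : Module.End ℂ V) - a • (1 : Module.End ℂ V)) ^ K) x = 0) :
    ∃ c : ℕ → ℂ, ∀ n : ℤ, l (((f ^ n : (Module.End ℂ V)ˣ) : Module.End ℂ V) x) =
      a ^ n * ∑ j ∈ Finset.range K, c j * ((Ring.choose n j : ℤ) : ℂ) := by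
  induction K generalizing x with
  | zero =>
    have : x = 0 := hx
    exact ⟨0, fun n => by simp [this]⟩
  | succ K ih =>
    rw [pow_succ, Module.End.mul_apply] at hx
    obtain ⟨c, hc⟩ := ih _ hx
    have step : ∀ n : ℤ, l (((f ^ (n + 1) : (Module.End ℂ V)ˣ) : Module.End ℂ V) x) =
        a * l (((f ^ n : (Module.End ℂ V)ˣ) : Module.End ℂ V) x) +
          a ^ n * ∑ j ∈ Finset.range K, c j * ((Ring.choose n j : ℤ) : ℂ) := by
      intro n
      rw [← hc, zpow_add_one]
      simp [Module.End.mul_apply]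
    -- The recursion `u(n + 1) = a u(n) + a^n ∑ c_j C(n, j)` is solved by `a^n ∑ c'_j C(n, j)`
    -- thanks to Pascal's rule; `c'` shifts `c`, divides by `a`, and starts with the value at `n =
    -- 0`.
    set c' : ℕ → ℂ := fun j => if j = 0 then l x else c (j - 1) / a with hc'
    have hsum : ∀ n : ℤ, ∑ j ∈ Finset.range (K + 1), c' j * ((Ring.choose n j : ℤ) : ℂ) =
        ∑ j ∈ Finset.range K, c j / a * ((Ring.choose n (j + 1) : ℤ) : ℂ) + l x := by
      intro n
      rw [Finset.sum_range_succ']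
      simp [hc']
    have hstep' : ∀ n : ℤ, ∑ j ∈ Finset.range (K + 1), c' j * ((Ring.choose (n + 1) j : ℤ) : ℂ) =
        ∑ j ∈ Finset.range (K + 1), c' j * ((Ring.choose n j : ℤ) : ℂ) +
          a⁻¹ * ∑ j ∈ Finset.range K, c j * ((Ring.choose n j : ℤ) : ℂ) := by
      intro n
      rw [hsum, hsum, Finset.mul_sum, add_right_comm, ← Finset.sum_add_distrib]
      congr 1
      refine Finset.sum_congr rfl fun j _ => ?_
      rw [Ring.choose_succ_succ]
      push_cast
      ring
    -- An equivalence, because the induction over `ℤ` runs in both directions; going down uses `a ≠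
    -- 0`.
    have hiff : ∀ n : ℤ, l (((f ^ n : (Module.End ℂ V)ˣ) : Module.End ℂ V) x) =
          a ^ n * ∑ j ∈ Finset.range (K + 1), c' j * ((Ring.choose n j : ℤ) : ℂ) ↔
        l (((f ^ (n + 1) : (Module.End ℂ V)ˣ) : Module.End ℂ V) x) =
          a ^ (n + 1) * ∑ j ∈ Finset.range (K + 1), c' j * ((Ring.choose (n + 1) j : ℤ) : ℂ) := by
      intro n
      rw [step, hstep', zpow_add_one₀ ha, mul_add, mul_assoc, mul_assoc, mul_left_comm (a ^ n) a,
        mul_inv_cancel_left₀ ha]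
      constructor
      · intro h; rw [h]
      · intro h
        exact mul_left_cancel₀ ha (add_right_cancel h)
    refine ⟨c', fun n => ?_⟩
    induction n using Int.induction_on with
    | zero => rw [hsum]; simp
    | succ n ih => exact (hiff _).1 ih
    | pred n ih => exact (hiff _).2 (by simpa using ih)

theorem zpow_apply_mem_subalgebra {R : Subalgebra ℂ (ℤ → ℂ)} (h : (fun n : ℤ => (n : ℂ)) ∈ R)
    (f : (Module.End ℂ V)ˣ) {M : Set ℂ} (hM0 : ∀ a ∈ M, a ≠ 0)
    (hM : ∀ a ∈ M, (fun n : ℤ => a ^ n) ∈ R)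
    (htop : ⨆ a ∈ M, (f : Module.End ℂ V).maxGenEigenspace a = ⊤) (x : V) (l : V →ₗ[ℂ] ℂ) :
    (fun n : ℤ => l (((f ^ n : (Module.End ℂ V)ˣ) : Module.End ℂ V) x)) ∈ R := by
  have hx : x ∈ ⨆ a ∈ M, (f : Module.End ℂ V).maxGenEigenspace a := by rw [htop]; trivial
  rw [iSup_subtype'] at hx
  induction hx using Submodule.iSup_induction' with
  | mem a x hx =>
    rw [Module.End.mem_maxGenEigenspace] at hx
    obtain ⟨K, hK⟩ := hx
    obtain ⟨c, hc⟩ := exists_zpow_apply_eq f (hM0 a a.2) l K x hK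
    have e : (fun n : ℤ => l (((f ^ n : (Module.End ℂ V)ˣ) : Module.End ℂ V) x)) =
        (fun n : ℤ => (a : ℂ) ^ n) *
          ∑ j ∈ Finset.range K, c j • fun n : ℤ => ((Ring.choose n j : ℤ) : ℂ) := by
      funext n
      rw [hc]
      simp
    rw [e]
    exact R.mul_mem (hM a a.2) (R.sum_mem fun j _ => R.smul_mem (choose_mem_subalgebra h j) _)
  | zero =>
    simp only [map_zero]
    exact R.zero_mem
  | add x y _ _ hx hy => simpa using! R.add_mem hx hy

end Iterates

/-! ### Matrix coefficients of one-parameter groups. -/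

section OneParameterGroups

theorem linearForm_apply_eq_sum_coord {ι V : Type*} [Fintype ι] [AddCommGroup V] [Module ℂ V]
    (b : Module.Basis ι ℂ V) (l : V →ₗ[ℂ] ℂ) (y : V) : l y = ∑ i, b.coord i y * l (b i) := by
  calc l y = l (∑ i, b.repr y i • b i) := by rw [b.sum_repr]
    _ = ∑ i, b.coord i y * l (b i) := by
      simp only [map_sum, map_smul, smul_eq_mul, Module.Basis.coord_apply]

variable {V : Type*} [CommRing V] [Algebra ℂ V] [FiniteDimensional ℂ V]

/-- The infinitesimal generator of a one-parameter group of algebra automorphisms. -/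
theorem exists_infinitesimal_generator {ψ : ℂ → V →ₐ[ℂ] V} (h0 : ∀ x, ψ 0 x = x)
    (hadd : ∀ s t x, ψ (s + t) x = ψ s (ψ t x))
    (hd : ∀ x (l : V →ₗ[ℂ] ℂ), DifferentiableAt ℂ (fun t => l (ψ t x)) 0) :
    ∃ B : Module.End ℂ V, (∀ x y, B (x * y) = B x * y + x * B y) ∧
      ∀ x (l : V →ₗ[ℂ] ℂ) t, HasDerivAt (fun t => l (ψ t x)) (l (ψ t (B x))) t := by
  set b := Module.finBasis ℂ V with hb
  have hexp := linearForm_apply_eq_sum_coord b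
  set B₀ : V → V := fun x => ∑ i, deriv (fun t => b.coord i (ψ t x)) 0 • b i with hB₀
  have hB : ∀ x (l : V →ₗ[ℂ] ℂ), HasDerivAt (fun t => l (ψ t x)) (l (B₀ x)) 0 := by
    intro x l
    have e : (fun t => l (ψ t x)) = fun t => ∑ i, b.coord i (ψ t x) * l (b i) :=
      funext fun t => hexp l _
    rw [e]
    have : l (B₀ x) = ∑ i, deriv (fun t => b.coord i (ψ t x)) 0 * l (b i) := by simp [hB₀]
    rw [this]
    exact HasDerivAt.fun_sum fun i _ => ((hd x (b.coord i)).hasDerivAt).mul_const _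
  have hsep : ∀ x y : V, (∀ l : V →ₗ[ℂ] ℂ, l x = l y) → x = y := fun x y h =>
    b.ext_elem fun i => h (b.coord i)
  refine ⟨⟨⟨B₀, fun x y => ?_⟩, fun c x => ?_⟩, fun x y => ?_, fun x l t => ?_⟩
  · refine hsep _ _ fun l => (hB (x + y) l).unique ?_
    simp only [map_add]
    exact (hB x l).add (hB y l)
  · refine hsep _ _ fun l => (hB (c • x) l).unique ?_
    simp only [map_smul, RingHom.id_apply]
    exact (hB x l).const_smul c
  · change B₀ (x * y) = B₀ x * y + x * B₀ y
    refine hsep _ _ fun l => (hB (x * y) l).unique ?_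
    -- Expanding the product in a basis reduces the Leibniz rule for `B₀` to the product rule for
    -- scalar functions.
    have hmul : ∀ u v, l (u * v) = ∑ i, b.coord i u * (l ∘ₗ LinearMap.mulLeft ℂ (b i)) v :=
      fun u v => hexp (l ∘ₗ LinearMap.mulRight ℂ v) u
    simp only [map_mul, map_add, hmul]
    rw [← Finset.sum_add_distrib]
    refine HasDerivAt.fun_sum fun i _ => ?_
    have := (hB x (b.coord i)).fun_mul (hB y (l ∘ₗ LinearMap.mulLeft ℂ (b i)))
    rwa [h0, h0] at this
  · change HasDerivAt (fun t => l (ψ t x)) (l (ψ t (B₀ x))) t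
    -- The group law transports the derivative at `0` to time `t`.
    have h1 := hB x (l ∘ₗ (ψ t).toLinearMap)
    rw [← sub_self t] at h1
    have h2 := HasDerivAt.comp_sub_const (x := t) t h1
    refine h2.congr_of_eventuallyEq (Eventually.of_forall fun s => ?_)
    simp [← hadd]

/-- Matrix coefficients of a one-parameter group at a generalized eigenvector of its infinitesimal
generator. -/
theorem exists_exp_apply_eq {V : Type*} [AddCommGroup V] [Module ℂ V] {ψ : ℂ → V →ₗ[ℂ] V}
    {B : Module.End ℂ V}
    (hB : ∀ x (l : V →ₗ[ℂ] ℂ) t, HasDerivAt (fun t => l (ψ t x)) (l (ψ t (B x))) t)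
    (a : ℂ) (l : V →ₗ[ℂ] ℂ) (K : ℕ) (x : V)
    (hx : ((B - a • (1 : Module.End ℂ V)) ^ K) x = 0) :
    ∃ c : ℕ → ℂ, ∀ t : ℂ, l (ψ t x) =
      Complex.exp (a * t) * ∑ j ∈ Finset.range K, c j * t ^ j := by
  induction K generalizing x with
  | zero =>
    have : x = 0 := hx
    exact ⟨0, fun n => by simp [this]⟩
  | succ K ih =>
    rw [pow_succ, Module.End.mul_apply] at hx
    obtain ⟨c, hc⟩ := ih _ hx
    -- Variation of constants: `e^{-at} l(ψ_t x)` has derivative `e^{-at} l(ψ_t ((B - a) x))`, a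
    -- polynomial by induction, whose primitive is subtracted.
    have hg : ∀ t, HasDerivAt (fun t => Complex.exp (-(a * t)) * l (ψ t x) -
        ∑ j ∈ Finset.range K, c j / (j + 1 : ℂ) * t ^ (j + 1)) 0 t := by
      intro t
      have h1 : HasDerivAt (fun t => Complex.exp (-(a * t)))
          (Complex.exp (-(a * t)) * (-(a * 1))) t :=
        ((hasDerivAt_id t).const_mul a).neg.cexp
      have h2 : HasDerivAt (fun t => ∑ j ∈ Finset.range K, c j / (j + 1 : ℂ) * t ^ (j + 1))
          (∑ j ∈ Finset.range K, c j / (j + 1 : ℂ) * (((j + 1 : ℕ) : ℂ) * t ^ j)) t :=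
        HasDerivAt.fun_sum fun j _ => (hasDerivAt_pow (j + 1) t).const_mul _
      have h3 := (h1.fun_mul (hB x l t)).fun_sub h2
      refine h3.congr_deriv ?_
      have h4 : ∑ j ∈ Finset.range K, c j / (j + 1 : ℂ) * (((j + 1 : ℕ) : ℂ) * t ^ j) =
          ∑ j ∈ Finset.range K, c j * t ^ j := by
        refine Finset.sum_congr rfl fun j _ => ?_
        have : (j + 1 : ℂ) ≠ 0 := by exact_mod_cast Nat.succ_ne_zero j
        push_cast
        field_simp
      have h5 := hc t
      simp only [LinearMap.sub_apply, LinearMap.smul_apply, Module.End.one_apply, map_sub,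
        map_smul, smul_eq_mul] at h5
      have h6 : Complex.exp (-(a * t)) * Complex.exp (a * t) = 1 := by
        rw [← Complex.exp_add]; simp
      rw [h4]
      have h7 : Complex.exp (-(a * t)) * (l (ψ t (B x)) - a * l (ψ t x)) =
          ∑ j ∈ Finset.range K, c j * t ^ j := by rw [h5, ← mul_assoc, h6, one_mul]
      rw [← h7]
      ring
    have hconst : ∀ t, Complex.exp (-(a * t)) * l (ψ t x) -
        ∑ j ∈ Finset.range K, c j / (j + 1 : ℂ) * t ^ (j + 1) = l (ψ 0 x) := by
      intro t
      have := is_const_of_deriv_eq_zero (fun t => (hg t).differentiableAt) (fun t => (hg t).deriv)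
        t 0
      simpa using this
    refine ⟨fun j => if j = 0 then l (ψ 0 x) else c (j - 1) / (j : ℂ), fun t => ?_⟩
    rw [Finset.sum_range_succ']
    have h6 : Complex.exp (a * t) * Complex.exp (-(a * t)) = 1 := by
      rw [← Complex.exp_add]; simp
    have h8 : Complex.exp (-(a * t)) * l (ψ t x) =
        ∑ j ∈ Finset.range K, c j / (j + 1 : ℂ) * t ^ (j + 1) + l (ψ 0 x) := by
      rw [← hconst t]; ring
    have h9 : l (ψ t x) = Complex.exp (a * t) * (Complex.exp (-(a * t)) * l (ψ t x)) := by
      rw [← mul_assoc, h6, one_mul]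
    rw [h9, h8]
    simp

theorem exp_apply_mem_subalgebra {V : Type*} [AddCommGroup V] [Module ℂ V]
    {R : Subalgebra ℂ (ℂ → ℂ)} (h : (fun t : ℂ => t) ∈ R) {ψ : ℂ → V →ₗ[ℂ] V}
    {B : Module.End ℂ V}
    (hB : ∀ x (l : V →ₗ[ℂ] ℂ) t, HasDerivAt (fun t => l (ψ t x)) (l (ψ t (B x))) t)
    {M : Set ℂ} (hM : ∀ a ∈ M, (fun t : ℂ => Complex.exp (a * t)) ∈ R)
    (htop : ⨆ a ∈ M, B.maxGenEigenspace a = ⊤) (x : V) (l : V →ₗ[ℂ] ℂ) :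
    (fun t : ℂ => l (ψ t x)) ∈ R := by
  have hx : x ∈ ⨆ a ∈ M, B.maxGenEigenspace a := by rw [htop]; trivial
  rw [iSup_subtype'] at hx
  induction hx using Submodule.iSup_induction' with
  | mem a x hx =>
    rw [Module.End.mem_maxGenEigenspace] at hx
    obtain ⟨K, hK⟩ := hx
    obtain ⟨c, hc⟩ := exists_exp_apply_eq hB a l K x hK
    have e : (fun t : ℂ => l (ψ t x)) = (fun t : ℂ => Complex.exp ((a : ℂ) * t)) *
          ∑ j ∈ Finset.range K, c j • (fun t : ℂ => t) ^ j := by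
      funext t
      rw [hc]
      simp
    rw [e]
    exact R.mul_mem (hM a a.2) (R.sum_mem fun j _ => R.smul_mem (R.pow_mem h j) _)
  | zero =>
    simp only [map_zero]
    exact R.zero_mem
  | add x y _ _ hx hy =>
    simp only [map_add]
    exact R.add_mem hx hy

end OneParameterGroups

/-! ### Jets and the endomorphisms induced on them. -/

section Jets

variable {d : ℕ}

/-- If the values differed, `φ` minus the constant `(a φ)(0)` would be a unit, while its image under
`a` vanishes at the origin. -/
theorem germEval_algHom_apply (a : HolGerm d →ₐ[ℂ] HolGerm d) (φ : HolGerm d) :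
    germEval d (a φ) = germEval d φ := by
  by_contra hne
  have h1 : IsUnit (φ - algebraMap ℂ (HolGerm d) (germEval d (a φ))) := by
    apply isUnit_of_germEval_ne_zero
    rw [map_sub, AlgHom.commutes, sub_ne_zero]
    exact fun h => hne h.symm
  have h2 := (h1.map a).map (germEval d)
  rw [map_sub, AlgHom.commutes, map_sub, AlgHom.commutes] at h2
  simp at h2

theorem germMax_pow_le_comap (a : HolGerm d →ₐ[ℂ] HolGerm d) (k : ℕ) :
    germMax d ^ k ≤ (germMax d ^ k).comap a := by
  rw [← Ideal.map_le_iff_le_comap, Ideal.map_pow]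
  refine Ideal.pow_right_mono (Ideal.map_le_iff_le_comap.2 fun φ hφ => ?_) k
  rw [Ideal.mem_comap, mem_germMax, germEval_algHom_apply]
  exact hφ

/-- The algebra of jets of order less than `k`. -/
def Jet (d k : ℕ) : Type := HolGerm d ⧸ germMax d ^ k

noncomputable instance (d k : ℕ) : CommRing (Jet d k) :=
  inferInstanceAs (CommRing (HolGerm d ⧸ germMax d ^ k))

noncomputable instance (d k : ℕ) : Algebra ℂ (Jet d k) :=
  inferInstanceAs (Algebra ℂ (HolGerm d ⧸ germMax d ^ k))

instance (d k : ℕ) : FiniteDimensional ℂ (Jet d k) := finite_quotient_germMax_pow d k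

/-- The jet of a germ. -/
noncomputable def Jet.mk (d k : ℕ) : HolGerm d →ₐ[ℂ] Jet d k := Ideal.Quotient.mkₐ ℂ (germMax d ^ k)

theorem Jet.mk_surjective (d k : ℕ) : Function.Surjective (Jet.mk d k) :=
  Ideal.Quotient.mk_surjective

theorem Jet.mk_eq_zero_iff {k : ℕ} {φ : HolGerm d} : Jet.mk d k φ = 0 ↔ φ ∈ germMax d ^ k :=
  Ideal.Quotient.eq_zero_iff_mem

/-- The action on jets of an algebra endomorphism of the ring of germs. -/
noncomputable def jetMap (k : ℕ) (a : HolGerm d →ₐ[ℂ] HolGerm d) :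
    Jet d k →ₐ[ℂ] Jet d k :=
  Ideal.quotientMapₐ _ a (germMax_pow_le_comap a k)

theorem jetMap_mk (k : ℕ) (a : HolGerm d →ₐ[ℂ] HolGerm d) (φ : HolGerm d) :
    jetMap k a (Jet.mk d _ φ) = Jet.mk d _ (a φ) := rfl

/-- The projection from jets of order `m` to jets of order `k`. -/
noncomputable def jetProj (d : ℕ) {k m : ℕ} (h : k ≤ m) :
    Jet d m →ₐ[ℂ] Jet d k :=
  Ideal.Quotient.factorₐ ℂ (Ideal.pow_le_pow_right h)

theorem jetProj_jetMap {k m : ℕ} (h : k ≤ m) (a : HolGerm d →ₐ[ℂ] HolGerm d)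
    (x : Jet d m) : jetProj d h (jetMap m a x) = jetMap k a (jetProj d h x) := by
  obtain ⟨φ, rfl⟩ := Jet.mk_surjective _ _ x
  rfl

/-- Reduction of all orders to `𝒪/𝔪²`: a generalized eigenvector whose eigenvalue does not occur
there projects to zero, hence lies in the square of the nilpotent image of `𝔪`. The order `k + 2`
ensures that the projection to `𝒪/𝔪²` exists. -/
theorem iSup_maxGenEigenspace_jets_eq_top {k : ℕ} {f : Module.End ℂ (Jet d (k + 2))}
    {g : Module.End ℂ (Jet d 2)}
    (hfg : ∀ x, jetProj d (Nat.le_add_left 2 k) (f x) = g (jetProj d (Nat.le_add_left 2 k) x))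
    {M : Set ℂ} (hM : ∀ a, g.HasEigenvalue a → a ∈ M)
    (hmul : ∀ a ∈ M, ∀ b ∈ M, ∀ x ∈ f.maxGenEigenspace a, ∀ y ∈ f.maxGenEigenspace b,
      ∃ c ∈ M, x * y ∈ f.maxGenEigenspace c) :
    ⨆ a ∈ M, f.maxGenEigenspace a = ⊤ := by
  refine iSup_maxGenEigenspace_eq_top_of_mul
    (N := (germMax d).map (Jet.mk d (k + 2))) ?_ hmul ?_
  · refine ⟨k + 2, ?_⟩
    rw [← Ideal.map_pow]
    exact (Ideal.map_eq_bot_iff_le_ker _).2 fun φ hφ => Jet.mk_eq_zero_iff.2 hφ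
  · intro a ha x hx
    have h0 := eq_zero_of_mem_maxGenEigenspace (fun h => ha (hM a h))
      (mem_maxGenEigenspace_of_intertwine (π := (jetProj d (Nat.le_add_left 2 k)).toLinearMap)
        hfg hx)
    obtain ⟨φ, rfl⟩ := Jet.mk_surjective _ _ x
    rw [← Ideal.map_pow]
    exact Ideal.mem_map_of_mem _ (Jet.mk_eq_zero_iff.1 h0)

end Jets

/-! ### The action of invertible germs on jets of functions. -/

section Pullback

variable {d : ℕ}

/-- The pullback of germs of functions under a germ of a holomorphic self-map. -/
noncomputable def pull (F : HolSelfMap d) : HolGerm d →ₐ[ℂ] HolGerm d where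
  toFun φ := ⟨φ.1.compTendsto' F.germ F.tendsto, by
    obtain ⟨_, u, hu, rfl⟩ := φ
    obtain ⟨_, f, hf, hf0, rfl⟩ := F
    exact ⟨u ∘ f, AnalyticAt.comp (by rwa [hf0]) hf, rfl⟩⟩
  map_one' := by
    obtain ⟨_, f, hf, hf0, rfl⟩ := F
    rfl
  map_mul' := by
    rintro ⟨_, u, hu, rfl⟩ ⟨_, v, hv, rfl⟩
    obtain ⟨_, f, hf, hf0, rfl⟩ := F
    rfl
  map_zero' := by
    obtain ⟨_, f, hf, hf0, rfl⟩ := F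
    rfl
  map_add' := by
    rintro ⟨_, u, hu, rfl⟩ ⟨_, v, hv, rfl⟩
    obtain ⟨_, f, hf, hf0, rfl⟩ := F
    rfl
  commutes' c := by
    obtain ⟨_, f, hf, hf0, rfl⟩ := F
    rfl

theorem pull_toGerm {F : HolSelfMap d} {f : Cd d → Cd d}
    (hf : F.germ = (f : Germ (𝓝 (0 : Cd d)) (Cd d))) (u : AnFun d) :
    (pull F (toGerm d u)).1 =
      ((fun x => (u : Cd d → ℂ) (f x) : Cd d → ℂ) : Germ (𝓝 (0 : Cd d)) ℂ) := by
  obtain ⟨_, h⟩ := F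
  obtain rfl := hf
  rfl

theorem pull_mul_apply (F G : HolSelfMap d) (φ : HolGerm d) :
    pull (F * G) φ = pull G (pull F φ) := by
  obtain ⟨_, u, hu, rfl⟩ := φ
  obtain ⟨_, f, hf, hf0, rfl⟩ := F
  obtain ⟨_, g, hg, hg0, rfl⟩ := G
  rfl

theorem pull_one_apply (φ : HolGerm d) : pull 1 φ = φ := by
  obtain ⟨_, u, hu, rfl⟩ := φ
  rfl

/-- The representation of invertible germs on jets of functions. -/
noncomputable def jetRep (d k : ℕ) : Diff d →* (Module.End ℂ (Jet d k))ˣ where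
  toFun F := ⟨(jetMap k (pull (F⁻¹ : Diff d))).toLinearMap, (jetMap k (pull F)).toLinearMap, by
      refine LinearMap.ext fun x => ?_
      obtain ⟨φ, rfl⟩ := Jet.mk_surjective _ _ x
      change Jet.mk d _ (pull _ (pull _ φ)) = _
      rw [← pull_mul_apply, Units.mul_inv, pull_one_apply]
      rfl, by
      refine LinearMap.ext fun x => ?_
      obtain ⟨φ, rfl⟩ := Jet.mk_surjective _ _ x
      change Jet.mk d _ (pull _ (pull _ φ)) = _
      rw [← pull_mul_apply, Units.inv_mul, pull_one_apply]
      rfl⟩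
  map_one' := by
    refine Units.ext (LinearMap.ext fun x => ?_)
    obtain ⟨φ, rfl⟩ := Jet.mk_surjective _ _ x
    change Jet.mk d _ (pull _ φ) = _
    rw [inv_one, Units.val_one, pull_one_apply]
    rfl
  map_mul' F G := by
    refine Units.ext (LinearMap.ext fun x => ?_)
    obtain ⟨φ, rfl⟩ := Jet.mk_surjective _ _ x
    change Jet.mk d _ (pull _ φ) = Jet.mk d _ (pull _ (pull _ φ))
    rw [← pull_mul_apply, mul_inv_rev, Units.val_mul]

theorem jetRep_inv_zpow_apply (k : ℕ) (F : Diff d) (n : ℤ) (x : Jet d k) :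
    (((jetRep d k F⁻¹) ^ n : (Module.End ℂ (Jet d k))ˣ) :
      Module.End ℂ (Jet d k)) x = jetMap k (pull ((F ^ n : Diff d) : HolSelfMap d)) x := by
  rw [← map_zpow, inv_zpow]
  change jetMap k (pull (((F ^ n)⁻¹⁻¹ : Diff d) : HolSelfMap d)) x = _
  rw [inv_inv]

end Pullback

/-! ### Jet coefficients of iterates and flows. -/

section Coefficients

variable {d : ℕ}

/-- The jet coefficients of the iterates of an invertible germ are polynomials in finitely many
functions on `ℤ`. -/
theorem exists_finset_zpow_coeff (F : Diff d) : ∃ S : Finset (ℤ → ℂ),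
    ∀ k φ (l : Jet d k →ₗ[ℂ] ℂ),
      (fun n : ℤ => l (Jet.mk d _ (pull ((F ^ n : Diff d) : HolSelfMap d) φ))) ∈
        Algebra.adjoin ℂ (S : Set (ℤ → ℂ)) := by
  classical
  set g : Module.End ℂ (Jet d 2) := (jetMap 2 (pull (F : HolSelfMap d))).toLinearMap
  set E : Finset ℂ := (Module.End.finite_hasEigenvalue g).toFinset with hE
  have hmemE : ∀ a, a ∈ E ↔ g.HasEigenvalue a := fun a => by simp [hE]
  -- The finite set depends only on the eigenvalues on `𝒪/𝔪²`; higher orders involve products of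
  -- these, whose powers are products of the chosen functions.
  refine ⟨insert (fun n : ℤ => (n : ℂ)) (E.image fun a (n : ℤ) => a ^ n), fun k φ l => ?_⟩
  set S : Finset (ℤ → ℂ) := insert (fun n : ℤ => (n : ℂ)) (E.image fun a (n : ℤ) => a ^ n) with hS
  set M : Submonoid ℂ := Submonoid.closure (E : Set ℂ) with hM
  have hg0 : ∀ a ∈ E, a ≠ 0 := by
    rintro a ha rfl
    obtain ⟨x, hx⟩ := ((hmemE 0).1 ha).exists_hasEigenvector
    have h1 : (jetRep d 2 F⁻¹ : Module.End ℂ (Jet d 2)) x = 0 := by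
      have := jetRep_inv_zpow_apply 2 F 1 x
      rw [zpow_one, zpow_one] at this
      rw [this]
      exact hx.apply_eq_smul.trans (zero_smul ℂ x)
    have h2 : (jetRep d 2 F⁻¹)⁻¹.val ((jetRep d 2 F⁻¹).val x) = x := by
      rw [← Module.End.mul_apply, Units.inv_mul, Module.End.one_apply]
    rw [h1, map_zero] at h2
    exact hx.2 h2.symm
  have hM0 : ∀ a ∈ (M : Set ℂ), a ≠ 0 := by
    intro a ha
    induction ha using Submonoid.closure_induction with
    | mem x hx => exact hg0 x hx
    | one => exact one_ne_zero
    | mul x y _ _ hx hy => exact mul_ne_zero hx hy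
  have hMS : ∀ a ∈ (M : Set ℂ), (fun n : ℤ => a ^ n) ∈ Algebra.adjoin ℂ (S : Set (ℤ → ℂ)) := by
    intro a ha
    induction ha using Submonoid.closure_induction with
    | mem x hx =>
      exact Algebra.subset_adjoin (Finset.mem_insert_of_mem (Finset.mem_image_of_mem _ hx))
    | one =>
      simp only [one_zpow]
      exact Subalgebra.one_mem _
    | mul x y _ _ hx hy =>
      simp only [mul_zpow]
      exact Subalgebra.mul_mem _ hx hy
  have hf : ((jetRep d (k + 2) F⁻¹) : Module.End ℂ (Jet d (k + 2))) =
      (jetMap (k + 2) (pull (F : HolSelfMap d))).toLinearMap := by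
    ext x
    have := jetRep_inv_zpow_apply (k + 2) F 1 x
    rwa [zpow_one, zpow_one] at this
  have key := zpow_apply_mem_subalgebra (R := Algebra.adjoin ℂ (S : Set (ℤ → ℂ)))
    (Algebra.subset_adjoin (Finset.mem_insert_self _ _)) (jetRep d (k + 2) F⁻¹) hM0 hMS (by
      rw [hf]
      refine iSup_maxGenEigenspace_jets_eq_top (g := g) (fun x => jetProj_jetMap _ _ x)
        (fun a ha => Submonoid.subset_closure ((hmemE a).2 ha)) ?_
      intro a ha b hb x hx y hy
      exact ⟨a * b, M.mul_mem ha hb, AlgHom.mul_mem_maxGenEigenspace _ hx hy⟩)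
    (Jet.mk d _ φ) (l ∘ₗ (jetProj d (Nat.le_add_right k 2)).toLinearMap)
  simp only [jetRep_inv_zpow_apply] at key
  exact key

/-- Hadamard's lemma in `x` gives `F(t, x) = F(t, 0) + ∑ x_i q_i(t, x)`, and `l` composed with
multiplication by `x_i` kills `𝔪^(k-1)`; induct on `k`. The germ is passed as a variable `φ` since
`F(t, ·)` is only known to be analytic for small `t`. -/
theorem exists_analyticAt_coeff {F : ℂ × Cd d → ℂ} (hF : AnalyticAt ℂ F 0) (k : ℕ)
    {l : HolGerm d →ₗ[ℂ] ℂ} (hl : ∀ φ ∈ germMax d ^ k, l φ = 0) :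
    ∃ H : ℂ → ℂ, AnalyticAt ℂ H 0 ∧ ∀ᶠ t in 𝓝 (0 : ℂ), ∀ φ : HolGerm d,
      φ.1 = ((fun x => F (t, x) : Cd d → ℂ) : Germ (𝓝 (0 : Cd d)) ℂ) → l φ = H t := by
  induction k generalizing F l with
  | zero => exact ⟨fun _ => 0, analyticAt_const, Eventually.of_forall fun t φ _ => hl φ (by simp)⟩
  | succ k ih =>
    obtain ⟨q, hq, h⟩ := exists_eq_add_sum_mul hF
      (fun i : Fin d => (ContinuousLinearMap.proj (R := ℂ) (φ := fun _ : Fin d => ℂ) i).comp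
        (ContinuousLinearMap.snd ℂ ℂ (Cd d)))
      (fun i => ((0 : ℂ), (Pi.single i 1 : Cd d))) (fun i j hij => by simp [hij]) Finset.univ
    have hproj : ∀ t x, ((t, x) : ℂ × Cd d) -
        ∑ i, x i • ((0 : ℂ), (Pi.single i 1 : Cd d)) = (t, 0) := by
      intro t x
      ext j
      · simp [Prod.fst_sum]
      · simp [Prod.snd_sum, Finset.sum_apply, Pi.single_apply]
    have hl' : ∀ i, ∀ φ ∈ germMax d ^ k,
        (l ∘ₗ LinearMap.mulLeft ℂ (toGerm d (coordFun d i))) φ = 0 := by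
      intro i φ hφ
      refine hl _ ?_
      rw [pow_succ']
      exact Ideal.mul_mem_mul (by rw [mem_germMax, germEval_toGerm]; rfl) hφ
    choose H hH hHe using fun i => ih (hq i) (hl' i)
    have hF0 : AnalyticAt ℂ (fun t : ℂ => F (t, 0)) 0 :=
      AnalyticAt.fun_comp (g := F) (f := fun t : ℂ => (t, (0 : Cd d))) hF
        (analyticAt_id.prod analyticAt_const)
    refine ⟨fun t => F (t, 0) * l 1 + ∑ i, H i t, ?_, ?_⟩
    · exact (hF0.mul analyticAt_const).add (Finset.analyticAt_fun_sum _ fun i _ => hH i)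
    · have h' : ∀ᶠ t in 𝓝 (0 : ℂ), ∀ᶠ x in 𝓝 (0 : Cd d),
          F (t, x) = F (t, 0) + ∑ i, x i * q i (t, x) := by
        rw [← Prod.mk_zero_zero, nhds_prod_eq] at h
        filter_upwards [h.curry] with t ht
        filter_upwards [ht] with x hx
        simp only [ContinuousLinearMap.comp_apply, ContinuousLinearMap.coe_snd',
          ContinuousLinearMap.proj_apply] at hx
        rw [hx, hproj]
      have htend : Tendsto (fun t : ℂ => (t, (0 : Cd d))) (𝓝 0) (𝓝 0) :=
        (Continuous.prodMk_left (0 : Cd d)).tendsto' _ _ rfl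
      have hqa : ∀ᶠ t in 𝓝 (0 : ℂ), ∀ i, AnalyticAt ℂ (q i) (t, 0) :=
        eventually_all.2 fun i => htend.eventually (hq i).eventually_analyticAt
      filter_upwards [h', hqa, eventually_all.2 hHe] with t h1 h2 h3 φ hφ
      have h4 : ∀ i, AnalyticAt ℂ (fun x : Cd d => q i (t, x)) 0 := fun i =>
        AnalyticAt.fun_comp (g := q i) (f := fun x : Cd d => (t, x)) (h2 i)
          (analyticAt_const.prod analyticAt_id)
      have h5 : φ = F (t, 0) • 1 + ∑ i, toGerm d (coordFun d i) * toGerm d ⟨_, h4 i⟩ := by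
        have e : F (t, 0) • (1 : HolGerm d) + ∑ i, toGerm d (coordFun d i) * toGerm d ⟨_, h4 i⟩ =
            toGerm d (F (t, 0) • 1 + ∑ i, coordFun d i * ⟨_, h4 i⟩) := by
          simp only [map_add, map_smul, map_one, map_sum, map_mul]
        rw [e, Subtype.ext_iff, hφ]
        refine Germ.coe_eq.2 ?_
        filter_upwards [h1] with x hx
        rw [hx, ← AnFun.eval_apply x]
        simp only [map_add, map_smul, map_one, map_sum, map_mul, smul_eq_mul, mul_one]
        rfl
      rw [h5, map_add, map_smul, map_sum, smul_eq_mul]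
      congr 1
      exact Finset.sum_congr rfl fun i _ => h3 i _ rfl

theorem IsFlow.map_zero {v : Cd d → Cd d} {φ : ℂ → Diff d} (h : IsFlow v φ) : φ 0 = 1 := by
  have := h.2.2.1 0 0
  rw [add_zero] at this
  exact by simpa using this

theorem IsFlow.differentiableAt_coeff {v : Cd d → Cd d} {φ : ℂ → Diff d} (h : IsFlow v φ) (k : ℕ)
    (x : Jet d k) (l : Jet d k →ₗ[ℂ] ℂ) :
    DifferentiableAt ℂ (fun t => l (jetMap k (pull (φ t : HolSelfMap d)) x)) 0 := by
  obtain ⟨u, rfl⟩ := Jet.mk_surjective _ _ x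
  obtain ⟨f, rfl⟩ := toGerm_surjective d u
  obtain ⟨Φ, hΦ, hgerm, -⟩ := h.2.2.2
  have hΦ0 : Φ (0, 0) = 0 := by
    have h1 := hgerm.self_of_nhds
    rw [h.map_zero] at h1
    exact (Germ.coe_eq.1 h1).self_of_nhds.symm
  obtain ⟨H, hH, he⟩ := exists_analyticAt_coeff (F := fun y => (f : Cd d → ℂ) (Φ y))
    (AnalyticAt.fun_comp (g := (f : Cd d → ℂ)) (by
      change AnalyticAt ℂ _ (Φ (0, 0))
      rw [hΦ0]
      exact f.2) hΦ) k (l := l ∘ₗ (Jet.mk d k).toLinearMap)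
    (fun ψ hψ => by
      change l (Jet.mk d _ ψ) = 0
      rw [Jet.mk_eq_zero_iff.2 hψ, _root_.map_zero])
  refine hH.differentiableAt.congr_of_eventuallyEq ?_
  filter_upwards [he, hgerm] with t h1 h2
  exact h1 _ (pull_toGerm h2 f)

/-- The jet coefficients of a flow are polynomials in finitely many functions of time. -/
theorem IsFlow.exists_finset_coeff {v : Cd d → Cd d} {φ : ℂ → Diff d} (h : IsFlow v φ) :
    ∃ S : Finset (ℂ → ℂ), ∀ k u (l : Jet d k →ₗ[ℂ] ℂ),
      (fun t : ℂ => l (Jet.mk d _ (pull (φ t : HolSelfMap d) u))) ∈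
        Algebra.adjoin ℂ (S : Set (ℂ → ℂ)) := by
  classical
  have hgen := fun k => exists_infinitesimal_generator
    (ψ := fun t => jetMap k (pull (φ t : HolSelfMap d)))
    (fun x => by
      obtain ⟨u, rfl⟩ := Jet.mk_surjective _ _ x
      rw [h.map_zero, jetMap_mk, Units.val_one, pull_one_apply])
    (fun s t x => by
      obtain ⟨u, rfl⟩ := Jet.mk_surjective _ _ x
      rw [add_comm, h.2.2.1, jetMap_mk, jetMap_mk, jetMap_mk, Units.val_mul, pull_mul_apply])
    (h.differentiableAt_coeff k)
  choose B hBmul hB using hgen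
  have hB0 : ∀ k x (l : Jet d k →ₗ[ℂ] ℂ),
      HasDerivAt (fun t => l (jetMap k (pull (φ t : HolSelfMap d)) x)) (l (B k x)) 0 := by
    intro k x l
    have h1 := hB k x l 0
    obtain ⟨u, hu⟩ := Jet.mk_surjective _ _ (B k x)
    rw [← hu] at h1 ⊢
    rwa [h.map_zero, jetMap_mk, Units.val_one, pull_one_apply] at h1
  -- The generators on different jet spaces are compatible: differentiate the compatibility of the
  -- flows at `t = 0`.
  have hcomp : ∀ k x, jetProj d (Nat.le_add_left 2 k) (B (k + 2) x) =
      B 2 (jetProj d (Nat.le_add_left 2 k) x) := by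
    intro k x
    refine (Module.finBasis ℂ (Jet d 2)).ext_elem fun i => ?_
    set l := (Module.finBasis ℂ (Jet d 2)).coord i
    have h1 := hB0 (k + 2) x (l ∘ₗ (jetProj d (Nat.le_add_left 2 k)).toLinearMap)
    have h2 := hB0 2 (jetProj d (Nat.le_add_left 2 k) x) l
    refine h1.unique (h2.congr_of_eventuallyEq (Eventually.of_forall fun t => ?_))
    exact congrArg l (jetProj_jetMap _ _ _)
  set E : Finset ℂ := (Module.End.finite_hasEigenvalue (B 2)).toFinset with hE
  have hmemE : ∀ a, a ∈ E ↔ (B 2).HasEigenvalue a := fun a => by simp [hE]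
  set S : Finset (ℂ → ℂ) := insert (fun t : ℂ => t) (E.image fun a (t : ℂ) => Complex.exp (a * t))
    with hS
  refine ⟨S, fun k u l => ?_⟩
  set M : AddSubmonoid ℂ := AddSubmonoid.closure (E : Set ℂ) with hM
  have hMS : ∀ a ∈ (M : Set ℂ), (fun t : ℂ => Complex.exp (a * t)) ∈
      Algebra.adjoin ℂ (S : Set (ℂ → ℂ)) := by
    intro a ha
    induction ha using AddSubmonoid.closure_induction with
    | mem x hx =>
      exact Algebra.subset_adjoin (Finset.mem_insert_of_mem (Finset.mem_image_of_mem _ hx))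
    | zero =>
      simp only [zero_mul, Complex.exp_zero]
      exact Subalgebra.one_mem _
    | add x y _ _ hx hy =>
      simp only [add_mul, Complex.exp_add]
      exact Subalgebra.mul_mem _ hx hy
  exact exp_apply_mem_subalgebra (R := Algebra.adjoin ℂ (S : Set (ℂ → ℂ)))
    (Algebra.subset_adjoin (Finset.mem_insert_self _ _))
    (ψ := fun t => (jetMap (k + 2) (pull (φ t : HolSelfMap d))).toLinearMap) (hB (k + 2)) hMS
    (iSup_maxGenEigenspace_jets_eq_top (g := B 2) (hcomp k)
        (fun a ha => AddSubmonoid.subset_closure ((hmemE a).2 ha)) (fun a ha b hb x hx y hy =>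
      ⟨a + b, M.add_mem ha hb, mul_mem_maxGenEigenspace_of_leibniz (hBmul (k + 2)) hx hy⟩))
    (Jet.mk d _ u) (l ∘ₗ (jetProj d (Nat.le_add_right k 2)).toLinearMap)

end Coefficients

/-! ### A parametrization of the group with coefficients in a Noetherian algebra. -/

section Parametrization

variable {d : ℕ} {P : Type*}

/-- Matrix coefficients of a composition are finite sums of products of matrix coefficients of the
factors. -/
theorem mul_coeff_mem {R : Subalgebra ℂ (P → ℂ)} {a b : P → Diff d}
    (ha : ∀ k u (l : Jet d k →ₗ[ℂ] ℂ), (fun x => l (Jet.mk d k (pull (a x : HolSelfMap d) u))) ∈ R)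
    (hb : ∀ k u (l : Jet d k →ₗ[ℂ] ℂ), (fun x => l (Jet.mk d k (pull (b x : HolSelfMap d) u))) ∈ R)
    (k : ℕ) (u : HolGerm d) (l : Jet d k →ₗ[ℂ] ℂ) :
    (fun x => l (Jet.mk d k (pull ((a x * b x : Diff d) : HolSelfMap d) u))) ∈ R := by
  set e := Module.finBasis ℂ (Jet d k)
  choose w hw using fun i => Jet.mk_surjective d k (e i)
  have h : (fun x => l (Jet.mk d k (pull ((a x * b x : Diff d) : HolSelfMap d) u))) =
      ∑ i, (fun x => e.coord i (Jet.mk d k (pull (a x : HolSelfMap d) u))) *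
        fun x => l (Jet.mk d k (pull (b x : HolSelfMap d) (w i))) := by
    funext x
    have := linearForm_apply_eq_sum_coord e
      (l ∘ₗ (jetMap k (pull (b x : HolSelfMap d))).toLinearMap) (Jet.mk d k (pull (a x) u))
    rw [Units.val_mul, pull_mul_apply, Finset.sum_apply]
    refine this.trans (Finset.sum_congr rfl fun i _ => ?_)
    rw [← hw i]
    rfl
  rw [h]
  exact R.sum_mem fun i _ => R.mul_mem (ha k u _) (hb k (w i) l)

/-- Composition with a map, as a homomorphism of algebras of functions. -/
noncomputable def precompAlgHom {P Q : Type*} (π : P → Q) : (Q → ℂ) →ₐ[ℂ] P → ℂ where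
  toFun s x := s (π x)
  map_one' := rfl
  map_mul' _ _ := rfl
  map_zero' := rfl
  map_add' _ _ := rfl
  commutes' _ := rfl

theorem precomp_mem_of_mem_adjoin {P Q : Type*} (π : P → Q) {S : Set (Q → ℂ)}
    {R : Subalgebra ℂ (P → ℂ)} (hS : ∀ s ∈ S, (fun x => s (π x)) ∈ R) {f : Q → ℂ}
    (hf : f ∈ Algebra.adjoin ℂ S) : (fun x => f (π x)) ∈ R :=
  (Algebra.adjoin_le (S := R.comap (precompAlgHom π)) hS) hf

/-- A commutative group generated by finitely many germs and flows is parametrized by a set on which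
all jet coefficients belong to a common Noetherian algebra of functions. -/
theorem exists_parametrization {A : Type*} [CommGroup A] (ρ : A →* Diff d) {p q : ℕ}
    (F : Fin p → A) (φ : Fin q → ℂ → A) (hadd : ∀ j s t, φ j (s + t) = φ j s * φ j t)
    (hφ : ∀ j, ∃ v, IsFlow v fun t => ρ (φ j t)) :
    ∃ (R : Subalgebra ℂ ((Fin p → ℤ) × (Fin q → ℂ) → ℂ))
      (c : (Fin p → ℤ) × (Fin q → ℂ) → A), IsNoetherianRing R ∧
      (∀ g ∈ Subgroup.closure ((Set.range fun i => ρ (F i)) ∪ ⋃ j, Set.range fun t => ρ (φ j t)),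
        ∃ x, ρ (c x) = g) ∧
      ∀ k u (l : Jet d k →ₗ[ℂ] ℂ),
        (fun x => l (Jet.mk d k (pull (ρ (c x) : HolSelfMap d) u))) ∈ R := by
  classical
  have hzero : ∀ j, φ j 0 = 1 := fun j => by simpa using hadd j 0 0
  have hneg : ∀ j t, φ j (-t) = (φ j t)⁻¹ := fun j t =>
    eq_inv_of_mul_eq_one_left (by rw [← hadd, neg_add_cancel, hzero])
  choose S hS using fun i => exists_finset_zpow_coeff (ρ (F i))
  choose v hv using hφ
  choose T hT using fun j => (hv j).exists_finset_coeff
  set U : Finset ((Fin p → ℤ) × (Fin q → ℂ) → ℂ) :=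
    (Finset.univ.biUnion fun i => (S i).image fun s x => s (x.1 i)) ∪
      Finset.univ.biUnion fun j => (T j).image fun s x => s (x.2 j) with hU
  -- Commutativity makes this a homomorphism from an additive group, so its image is closed under
  -- products and inverses.
  set c : (Fin p → ℤ) × (Fin q → ℂ) → A :=
    (∏ i, fun x : (Fin p → ℤ) × (Fin q → ℂ) => F i ^ x.1 i) * ∏ j, fun x => φ j (x.2 j) with hc
  have hcx : ∀ x, c x = (∏ i, F i ^ x.1 i) * ∏ j, φ j (x.2 j) := fun x => by
    simp [hc, Finset.prod_apply]
  refine ⟨Algebra.adjoin ℂ (U : Set ((Fin p → ℤ) × (Fin q → ℂ) → ℂ)), c, ?_, ?_, ?_⟩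
  · exact isNoetherianRing_of_fg (Subalgebra.fg_adjoin_finset U)
  · intro g hg
    induction hg using Subgroup.closure_induction with
    | mem g hg =>
      rcases hg with ⟨i, rfl⟩ | hg
      · refine ⟨(Pi.single i 1, 0), congrArg ρ ?_⟩
        rw [hcx, Fintype.prod_eq_single i fun i' hi => by simp [hi]]
        simp [hzero]
      · obtain ⟨j, t, rfl⟩ := Set.mem_iUnion.1 hg
        refine ⟨(0, Pi.single j t), congrArg ρ ?_⟩
        rw [hcx, Fintype.prod_eq_single j fun j' hj => by simp [hj, hzero]]
        simp
    | one => exact ⟨0, by rw [hcx]; simp [hzero]⟩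
    | mul g h _ _ hg hh =>
      obtain ⟨x, rfl⟩ := hg
      obtain ⟨y, rfl⟩ := hh
      refine ⟨x + y, ?_⟩
      rw [← map_mul, hcx, hcx, hcx]
      simp only [Prod.fst_add, Prod.snd_add, Pi.add_apply, zpow_add, hadd, Finset.prod_mul_distrib]
      rw [mul_mul_mul_comm]
    | inv g _ hg =>
      obtain ⟨x, rfl⟩ := hg
      refine ⟨-x, ?_⟩
      rw [← map_inv, hcx, hcx]
      simp only [Prod.fst_neg, Prod.snd_neg, Pi.neg_apply, zpow_neg, hneg, Finset.prod_inv_distrib,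
        mul_inv]
  · set R := Algebra.adjoin ℂ (U : Set ((Fin p → ℤ) × (Fin q → ℂ) → ℂ))
    let good : ((Fin p → ℤ) × (Fin q → ℂ) → A) → Prop := fun a =>
      ∀ k u (l : Jet d k →ₗ[ℂ] ℂ), (fun x => l (Jet.mk d k (pull (ρ (a x) : HolSelfMap d) u))) ∈ R
    have hone : good 1 := by
      intro k u l
      simp only [Pi.one_apply, map_one, Units.val_one, pull_one_apply]
      exact R.algebraMap_mem (l (Jet.mk d k u))
    have hmul : ∀ a b, good a → good b → good (a * b) := by
      intro a b ha hb k u l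
      simp only [Pi.mul_apply, map_mul ρ]
      exact mul_coeff_mem ha hb k u l
    refine hmul _ _ (Finset.prod_induction _ good hmul hone fun i _ k u l => ?_)
      (Finset.prod_induction _ good hmul hone fun j _ k u l => ?_)
    · simp only [map_zpow]
      refine precomp_mem_of_mem_adjoin (fun x : (Fin p → ℤ) × (Fin q → ℂ) => x.1 i)
        (fun s hs => Algebra.subset_adjoin ?_) (hS i k u l)
      exact Finset.mem_union_left _ (Finset.mem_biUnion.2
        ⟨i, Finset.mem_univ _, Finset.mem_image_of_mem _ hs⟩)
    · refine precomp_mem_of_mem_adjoin (fun x : (Fin p → ℤ) × (Fin q → ℂ) => x.2 j)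
        (fun s hs => Algebra.subset_adjoin ?_) (hT j k u l)
      exact Finset.mem_union_right _ (Finset.mem_biUnion.2
        ⟨j, Finset.mem_univ _, Finset.mem_image_of_mem _ hs⟩)

end Parametrization

/-! ### Ideals of preimages and finiteness of isolated multiplicities. -/

section Subvarieties

variable {d : ℕ}

theorem pull_mem_vanishingIdeal (g : Diff d) {X : SetGerm d} {φ : HolGerm d}
    (hφ : φ ∈ vanishingIdeal X) : pull (g : HolSelfMap d) φ ∈ vanishingIdeal (preimage g X) := by
  induction X using Germ.inductionOn with | _ X =>
  obtain ⟨_, u, hu, rfl⟩ := φ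
  obtain ⟨⟨_, f, hf, hf0, rfl⟩, _, _, _⟩ := g
  change ∀ᶠ x in 𝓝 0, X x → u x = 0 at hφ
  change ∀ᶠ x in 𝓝 0, X (f x) → u (f x) = 0
  have : Tendsto f (𝓝 0) (𝓝 0) := by simpa [ContinuousAt, hf0] using hf.continuousAt
  exact this.eventually hφ

theorem compTendsto_compTendsto_of_mul_eq_one {a b : HolSelfMap d} (h : a * b = 1)
    (X : SetGerm d) :
    Germ.compTendsto' (Germ.compTendsto' X a.germ a.tendsto) b.germ b.tendsto = X := by
  induction X using Germ.inductionOn with | _ X =>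
  obtain ⟨_, f, hf, hf0, rfl⟩ := a
  obtain ⟨_, f', hf', hf0', rfl⟩ := b
  have h1 : ∀ᶠ x in 𝓝 (0 : Cd d), f (f' x) = x := Germ.coe_eq.1 (congrArg HolSelfMap.germ h)
  refine Germ.coe_eq.2 ?_
  filter_upwards [h1] with x hx
  exact congrArg X hx

theorem preimage_inv_preimage (g : Diff d) (X : SetGerm d) : preimage g⁻¹ (preimage g X) = X :=
  compTendsto_compTendsto_of_mul_eq_one (Units.mul_inv g) X

theorem mem_vanishingIdeal_preimage_iff (g : Diff d) {X : SetGerm d} {φ : HolGerm d} :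
    φ ∈ vanishingIdeal (preimage g X) ↔ ∃ ψ ∈ vanishingIdeal X, pull (g : HolSelfMap d) ψ = φ := by
  constructor
  · intro h
    refine ⟨pull ((g⁻¹ : Diff d) : HolSelfMap d) φ, ?_, ?_⟩
    · have := pull_mem_vanishingIdeal g⁻¹ h
      rwa [preimage_inv_preimage] at this
    · rw [← pull_mul_apply, Units.inv_mul, pull_one_apply]
  · rintro ⟨ψ, hψ, rfl⟩
    exact pull_mem_vanishingIdeal g hψ

theorem codim_ne_top_of_finite {K : Ideal (HolGerm d)} (h : Module.Finite ℂ (HolGerm d ⧸ K)) :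
    codim K ≠ ⊤ := by
  rw [codim, ne_eq, Cardinal.toENat_eq_top, not_le]
  exact Module.rank_lt_aleph0 ℂ _

/-- An isolated intersection has finite multiplicity. -/
theorem codim_ne_top_of_isIsolatedIntersection {X Y : SetGerm d} (hX : IsAnalyticSubvariety X)
    (hY : IsAnalyticSubvariety Y) (h : IsIsolatedIntersection X Y) :
    codim (vanishingIdeal X ⊔ vanishingIdeal Y) ≠ ⊤ := by
  obtain ⟨m, f, hf, rfl⟩ := hX
  obtain ⟨n, f', hf', rfl⟩ := hY
  have h' : ∀ᶠ x in 𝓝 (0 : Cd d), ((∀ i, f i x = 0) ∧ ∀ i, f' i x = 0) → x = 0 := h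
  set a : Fin (m + n) → AnFun d :=
    Fin.append (fun i => ⟨f i, hf i⟩) (fun i => ⟨f' i, hf' i⟩) with ha
  have hfin := finite_quotient_of_isolated d a (by
    filter_upwards [h'] with x hx h0
    refine hx ⟨fun i => ?_, fun i => ?_⟩
    · simpa [ha] using h0 (Fin.castAdd n i)
    · simpa [ha] using h0 (Fin.natAdd m i))
  have hle : Ideal.span (Set.range fun i => toGerm d (a i)) ≤
      vanishingIdeal ((fun x => ∀ i, f i x = 0 : Cd d → Prop) : SetGerm d) ⊔
        vanishingIdeal ((fun x => ∀ i, f' i x = 0 : Cd d → Prop) : SetGerm d) := by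
    rw [Ideal.span_le]
    rintro _ ⟨i, rfl⟩
    refine Fin.addCases (fun i => ?_) (fun i => ?_) i
    · refine Ideal.mem_sup_left ?_
      simp only [ha, Fin.append_left]
      exact Eventually.of_forall fun x hx => hx i
    · refine Ideal.mem_sup_right ?_
      simp only [ha, Fin.append_right]
      exact Eventually.of_forall fun x hx => hx i
  exact codim_ne_top_of_finite (Module.Finite.of_surjective
    (Ideal.Quotient.factorₐ ℂ hle).toLinearMap (Ideal.Quotient.factor_surjective hle))

theorem isAnalyticSubvariety_preimage (g : Diff d) {X : SetGerm d} (hX : IsAnalyticSubvariety X) :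
    IsAnalyticSubvariety (preimage g X) := by
  obtain ⟨m, f, hf, rfl⟩ := hX
  obtain ⟨⟨_, g, hg, hg0, rfl⟩, _, _, _⟩ := g
  exact ⟨m, fun i x => f i (g x), fun i =>
    AnalyticAt.fun_comp (g := f i) (by rw [hg0]; exact hf i) hg, rfl⟩

end Subvarieties

end LocalDynamics

theorem mainTheorem2 (d : ℕ) (G : Subgroup (LocalDynamics.Diff d))
    (hfin : LocalDynamics.IsFinitelyGenerated G)
    (hcomm : ∀ g ∈ G, ∀ h ∈ G, g * h = h * g)
    (X Y : LocalDynamics.SetGerm d)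
    (hX : LocalDynamics.IsAnalyticSubvariety X) (hY : LocalDynamics.IsAnalyticSubvariety Y) :
    ∃ m : ℕ, ∀ g ∈ G,
      LocalDynamics.IsIsolatedIntersection (LocalDynamics.preimage g X) Y →
        LocalDynamics.intersectionMultiplicity (LocalDynamics.preimage g X) Y ≤ (m : ℕ∞) := by
  open LocalDynamics in
  obtain ⟨p, q, F, v, φ, hφ, hG⟩ := hfin
  have hF : ∀ i, F i ∈ G := fun i => by
    rw [hG]
    exact Subgroup.subset_closure (Or.inl ⟨i, rfl⟩)
  have hφG : ∀ j t, φ j t ∈ G := fun j t => by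
    rw [hG]
    exact Subgroup.subset_closure (Or.inr (Set.mem_iUnion.2 ⟨j, t, rfl⟩))
  let _ : CommGroup G :=
    { (inferInstance : Group G) with mul_comm := fun a b => Subtype.ext (hcomm a a.2 b b.2) }
  obtain ⟨R, c, hR, hsurj, hcoeff⟩ := exists_parametrization (A := G) G.subtype
    (fun i => ⟨F i, hF i⟩) (fun j t => ⟨φ j t, hφG j t⟩)
    (fun j s t => Subtype.ext ((hφ j).2.2.1 s t)) (fun j => ⟨v j, hφ j⟩)
  -- All elements of `I_X` and `I_Y` serve as indices: the pullbacks of the former already form the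
  -- ideal of `g⁻¹(X)`, so the complex span is the whole sum, and no finite generation is required.
  obtain ⟨m, hm⟩ := exists_codim_bound R
    (fun x => vanishingIdeal (preimage (c x : Diff d) X) ⊔ vanishingIdeal Y)
    (ι := vanishingIdeal X ⊕ vanishingIdeal Y)
    (fun i x => Sum.elim (fun a : vanishingIdeal X => pull ((c x : Diff d) : HolSelfMap d) a)
      (fun b : vanishingIdeal Y => (b : HolGerm d)) i)
    (fun x => by
      apply Set.Subset.antisymm
      · refine Submodule.span_le (p := Submodule.restrictScalars ℂ
          (vanishingIdeal (preimage (c x : Diff d) X) ⊔ vanishingIdeal Y)).2 ?_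
        rintro _ ⟨a | b, rfl⟩
        · exact Ideal.mem_sup_left (pull_mem_vanishingIdeal _ a.2)
        · exact Ideal.mem_sup_right b.2
      · intro φ hφ
        obtain ⟨_, h1, b, hb, rfl⟩ := Submodule.mem_sup.1 hφ
        obtain ⟨a, ha, rfl⟩ := (mem_vanishingIdeal_preimage_iff _).1 h1
        exact Submodule.add_mem _ (Submodule.subset_span ⟨Sum.inl ⟨a, ha⟩, rfl⟩)
          (Submodule.subset_span ⟨Sum.inr ⟨b, hb⟩, rfl⟩))
    (fun k i l => by
      rcases i with a | b
      · exact hcoeff k a l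
      · exact R.algebraMap_mem (l (Ideal.Quotient.mk _ b.1)))
  refine ⟨m, fun g hg hiso => ?_⟩
  obtain ⟨x, rfl⟩ := hsurj g (by rwa [hG] at hg)
  exact hm x (codim_ne_top_of_isIsolatedIntersection (isAnalyticSubvariety_preimage _ hX) hY hiso)
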